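/- **Setting.** For a prime $p$ and a scheme $Y$ of finite type over $\mathbf F_p$ let $Z(Y,t)=\exp\big(\sum_{m\ge1}\#Y(\mathbf F_{p^m})\,t^m/m\big)$, let $P(\alpha)=t^{\deg\alpha}/Z(Y,t)$ for every effective zero-cycle $\alpha$ of $Y$ (a finite formal sum $\sum n_x x$ of closed points with $n_x\in\mathbf N$ and $\deg\alpha=\sum n_x[\kappa(x):\mathbf F_p]$), and let $S(Y,t)=-\sum_\alpha P(\alpha)\log P(\alpha)$ be the Shannon entropy. For $X$ over $\mathbf Z$ with reductions $X_p=X\times\mathrm{Spec}\,\mathbf F_p$ and no primes of bad reduction, put $$L(X,s)=\prod_p Z(X_p,p^{-s}),\qquad S_{\mathbf Z}(X,s)=\sum_p S(X_p,p^{-s})$$ for real $s$. A physical system with energy levels $\{\log k\}_{k\ge1}$ and degeneracies $D_k$ is a system with a Hamiltonian $H$ that is diagonal in an orthonormal basis, whose eigenvalues are exactly the numbers $\log k$, $k\ge1$, the eigenspace of $\log k$ having dimension $D_k$; its partition function is $Z(\beta)=\mathrm{Tr}\,e^{-\beta H}$ and its thermodynamical entropy at inverse temperature $\beta$ is $(1-\beta\,\partial/\partial\beta)\log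 Z(\beta)$. A matrix $M\in M_N(\mathbf Z)$ is reduced if it is lower triangular with $M_{jj}\ge0$ and $0\le M_{ij}<M_{jj}$ for $i>j$; $\mathrm{Red}_N(k)$ is the set of reduced $N\times N$ matrices of determinant $k$. **Lemma 6.3.1.** Let $n\ge0$. In each case below, in the stated range of $s$, all the sums and products above converge, the $P(\alpha)$ form a probability distribution for each $p$, $S_{\mathbf Z}(X,s)=\left(1-s\frac{d}{ds}\right)\log L(X,s)$, and: 1. For $s>1$, $$S_{\mathbf Z}(\mathrm{Spec}\,\mathbf Z,s)=\left(1-s\tfrac{d}{ds}\right)\log\zeta(s),$$ and this is the thermodynamical entropy, at inverse temperature $s$, of a physical system with non-degenerate energy levels $\{\log k\}_{k\ge1}$. Such systems are realised, for instance, by the Julia system (bosonic occupation numbers $(n_p)_p$, energy $\sum_p n_p\log p$) and by the Hamiltonian $H\varepsilon_k=\log k\;\varepsilon_k$ of the Bost–Connes system on $\ell^2(\mathbf N_{\ge1})$. 2. For $s>n+1$, $$S_{\mathbf Z}(\mathbf A^n,s)=\left(1-s\tfrac{d}{ds}\right)\log\zeta(s-n),$$ and this is the thermodynamical entropy, at inverse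 temperature $s$, of a physical system with energy levels $\{\log k\}_{k\ge1}$ and degeneracies $D_k=k^n$; such systems exist. 3. For $s>n+1$, $$S_{\mathbf Z}(\mathbf P^n,s)=\left(1-s\tfrac{d}{ds}\right)\sum_{m=0}^n\log\zeta(s-m),$$ and this is the thermodynamical entropy, at inverse temperature $s$, of a physical system with energy levels $\{\log k\}_{k\ge1}$ and degeneracies $D_k=\#\mathrm{Red}_{n+1}(k)$. Such a system is realised by the Hamiltonian $H\varepsilon_M=\log\det(M)\,\varepsilon_M$ of the $GL_{n+1}$-version of the Bost–Connes system on $\ell^2\big(SL_{n+1}(\mathbf Z)\backslash\{M\in M_{n+1}(\mathbf Z):\det M>0\}\big)$. -/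

import Mathlib

open CategoryTheory CategoryTheory.Limits AlgebraicGeometry

noncomputable section

/-! ### Entropy as a differential operator -/

/-- `S = (1 - x d/dx) F` at the point `x = s`; differentiability of `F` at `s` is part of it. -/
def IsOneSubMulDeriv {𝕜 : Type} [NontriviallyNormedField 𝕜] (F : 𝕜 → 𝕜) (s S : 𝕜) : Prop :=
  ∃ F' : 𝕜, HasDerivAt F F' s ∧ S = F s - s * F'

/-! ### Zeta function and Shannon entropy of a scheme over `𝔽_p` -/

section FiniteField

variable (p : ℕ) [Fact p.Prime] {X : Scheme.{0}} (f : X ⟶ Spec (CommRingCat.of (ZMod p)))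

/-- `card X(𝔽_{p^m})` (for `m ≥ 1`): the number of morphisms `Spec 𝔽_{p^m} ⟶ X` over `𝔽_p`. -/
def pointCount (m : ℕ) : ℕ :=
  Nat.card {g : Spec (CommRingCat.of (GaloisField p m)) ⟶ X //
    g ≫ f = Spec.map (CommRingCat.ofHom (algebraMap (ZMod p) (GaloisField p m)))}

/-- The `m`-th term (counted from `m = 0`) of `∑_{m ≥ 1} card X(𝔽_{p^m}) t^m / m`. -/
def hasseWeilTerm (t : ℝ) (m : ℕ) : ℝ :=
  (pointCount p f (m + 1) : ℝ) * t ^ (m + 1) / ((m + 1 : ℕ) : ℝ)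

/-- The Hasse--Weil zeta function `exp (∑_{m ≥ 1} card X(𝔽_{p^m}) t^m / m)`. -/
def hasseWeilZeta (t : ℝ) : ℝ :=
  Real.exp (∑' m : ℕ, hasseWeilTerm p f t m)

/-- Effective zero-cycles: finite formal sums of closed points with coefficients in `ℕ`. -/
abbrev EffectiveZeroCycle (X : Scheme.{0}) : Type :=
  {x : X // IsClosed ({x} : Set X)} →₀ ℕ

/-- The degree `∑ n_x [κ(x) : 𝔽_p]` of the effective zero-cycle `∑ n_x x`. -/
def zeroCycleDegree (α : EffectiveZeroCycle X) : ℕ :=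
  α.sum fun x k => k * f.residueDegree x.1

/-- The weight `P(α) = t^{deg α} / Z(X, t)` of an effective zero-cycle. -/
def zeroCycleProb (t : ℝ) (α : EffectiveZeroCycle X) : ℝ :=
  t ^ zeroCycleDegree p f α / hasseWeilZeta p f t

/-- The Shannon entropy `S(X, t) = - ∑_α P(α) log P(α)`. -/
def shannonEntropy (t : ℝ) : ℝ :=
  ∑' α : EffectiveZeroCycle X, -(zeroCycleProb p f t α * Real.log (zeroCycleProb p f t α))

end FiniteField

/-! ### `L`-function and Shannon entropy of a scheme over `ℤ` -/

instance factPrimeOfPrimes (p : Nat.Primes) : Fact (p : ℕ).Prime := ⟨p.2⟩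

section Integers

variable (X : Scheme.{0})

/-- The structure morphism `X_p ⟶ Spec 𝔽_p` of the reduction `X_p = X ×_{Spec ℤ} Spec 𝔽_p`. -/
def reductionMod (p : Nat.Primes) :
    pullback (specZIsTerminal.from X)
      (Spec.map (CommRingCat.ofHom (Int.castRingHom (ZMod p)))) ⟶
    Spec (CommRingCat.of (ZMod p)) :=
  pullback.snd _ _

/-- The local factor `Z(X_p, p^{-s})`. -/
def localZeta (s : ℝ) (p : Nat.Primes) : ℝ :=
  hasseWeilZeta p (reductionMod X p) ((p : ℝ) ^ (-s))

/-- The local entropy `S(X_p, s)`: the Shannon entropy of `X_p` at `t = p^{-s}`. -/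
def localEntropy (s : ℝ) (p : Nat.Primes) : ℝ :=
  shannonEntropy p (reductionMod X p) ((p : ℝ) ^ (-s))

/-- The non-completed `L`-function `L(X, s) = ∏_p Z(X_p, p^{-s})` (no primes of bad reduction). -/
def LFunctionZ (s : ℝ) : ℝ := ∏' p : Nat.Primes, localZeta X s p

/-- The Shannon entropy `S_ℤ(X, s) = ∑_p S(X_p, s)`. -/
def entropyZ (s : ℝ) : ℝ := ∑' p : Nat.Primes, localEntropy X s p

/-- Convergence, at `s`, of all the series and products that enter `L(X, s)` and `S_ℤ(X, s)`;
the weights `P(α)` on the zero-cycles of each `X_p` form a probability distribution. -/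
structure EntropyConverges (s : ℝ) : Prop where
  finite_points : ∀ (p : Nat.Primes) (m : ℕ), 1 ≤ m →
    Finite {g : Spec (CommRingCat.of (GaloisField p m)) ⟶ _ // g ≫ reductionMod X p =
      Spec.map (CommRingCat.ofHom (algebraMap (ZMod p) (GaloisField p m)))}
  zeta_series : ∀ p : Nat.Primes,
    Summable (hasseWeilTerm p (reductionMod X p) ((p : ℝ) ^ (-s)))
  probability : ∀ p : Nat.Primes,
    HasSum (zeroCycleProb p (reductionMod X p) ((p : ℝ) ^ (-s))) 1
  local_entropy : ∀ p : Nat.Primes, Summable fun α =>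
    zeroCycleProb p (reductionMod X p) ((p : ℝ) ^ (-s)) α *
      Real.log (zeroCycleProb p (reductionMod X p) ((p : ℝ) ^ (-s)) α)
  euler_product : Multipliable (localZeta X s)
  L_pos : 0 < LFunctionZ X s
  entropy : Summable (localEntropy X s)

end Integers

section ProjectiveSpace

attribute [local instance] MvPolynomial.gradedAlgebra

/-- Projective space `ℙⁿ = Proj ℤ[x₀, …, xₙ]` over `ℤ`. -/
def projectiveSpaceZ (n : ℕ) : Scheme.{0} :=
  Proj (MvPolynomial.homogeneousSubmodule (Fin (n + 1)) ℤ)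

end ProjectiveSpace

/-- Affine space `𝔸ⁿ` over `ℤ`. -/
def affineSpaceZ (n : ℕ) : Scheme.{0} :=
  AffineSpace (Fin n) (Spec (CommRingCat.of ℤ))

/-! ### Physical systems -/

/-- A quantum system whose Hamiltonian `H` is diagonal: `State` indexes an orthonormal basis of
eigenvectors `ε_x` of the Hilbert space `ℓ²(State)`, and `H ε_x = energy x • ε_x`. -/
structure PhysicalSystem where
  State : Type
  energy : State → ℝ

namespace PhysicalSystem

/-- The partition function `Z(β) = Tr e^{-βH}`. -/
def partitionFunction (Q : PhysicalSystem) (β : ℝ) : ℝ :=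
  ∑' x : Q.State, Real.exp (-β * Q.energy x)

/-- `S` is the thermodynamical entropy `(1 - β ∂/∂β) log Z(β)` of the system at inverse
temperature `β` (where `Z(β)` converges). -/
def IsThermalEntropy (Q : PhysicalSystem) (β S : ℝ) : Prop :=
  Summable (fun x : Q.State => Real.exp (-β * Q.energy x)) ∧
    IsOneSubMulDeriv (fun b : ℝ => Real.log (Q.partitionFunction b)) β S

/-- The energy levels are exactly `log k`, `k ≥ 1`, and the level `log k` has degeneracy
(dimension of its eigenspace) `D k`. -/
def HasLogLevels (Q : PhysicalSystem) (D : ℕ+ → ℕ) : Prop :=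
  Set.range Q.energy = Set.range (fun k : ℕ+ => Real.log (k : ℝ)) ∧
    ∀ k : ℕ+, Finite {x : Q.State // Q.energy x = Real.log (k : ℝ)} ∧
      Nat.card {x : Q.State // Q.energy x = Real.log (k : ℝ)} = D k

/-- The Julia system: the free boson gas with one-particle energies `log p`, `p` prime. Its states
are the occupation numbers `(n_p)_p`, almost all zero, with energy `∑_p n_p log p`. -/
def julia : PhysicalSystem where
  State := Nat.Primes →₀ ℕ
  energy n := n.sum fun p k => (k : ℝ) * Real.log (p : ℝ)

/-- The Hamiltonian of the Bost--Connes system, in its representation on `ℓ²(ℕ_{≥ 1})`: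
`H ε_k = log k • ε_k`. -/
def bostConnes : PhysicalSystem where
  State := ℕ+
  energy k := Real.log (k : ℝ)

end PhysicalSystem

/-- Integral `N × N` matrices with positive determinant, up to multiplication by `SL_N(ℤ)` from
the left. -/
def posDetSetoid (N : ℕ) : Setoid {M : Matrix (Fin N) (Fin N) ℤ // 0 < M.det} where
  r M M' := ∃ γ : Matrix.SpecialLinearGroup (Fin N) ℤ, M'.1 = γ.1 * M.1
  iseqv := by
    refine ⟨fun M => ⟨1, by simp⟩, ?_, ?_⟩
    · rintro M M' ⟨γ, h⟩
      refine ⟨γ⁻¹, ?_⟩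
      rw [h, ← Matrix.mul_assoc, ← Matrix.SpecialLinearGroup.coe_mul]
      simp
    · rintro M M' M'' ⟨γ, h⟩ ⟨δ, h'⟩
      refine ⟨δ * γ, ?_⟩
      rw [h', h, Matrix.SpecialLinearGroup.coe_mul, Matrix.mul_assoc]

/-- The Hamiltonian of the `GL_N`-version of the Bost--Connes system, in its representation on
`ℓ²(SL_N(ℤ) \ M_N(ℤ)⁺)`: `H ε_M = log (det M) • ε_M`. -/
def PhysicalSystem.bostConnesGL (N : ℕ) : PhysicalSystem where
  State := Quotient (posDetSetoid N)
  energy := Quotient.lift (fun M => Real.log ((M.1.det : ℤ) : ℝ)) (by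
    rintro M M' ⟨γ, h⟩
    rw [h, Matrix.det_mul, γ.2, one_mul])

/-! ### Reduced matrices -/

/-- A reduced matrix: lower triangular with `M j j ≥ 0`, and `0 ≤ M i j < M j j` below the
diagonal. -/
def IsReducedMatrix {N : ℕ} (M : Matrix (Fin N) (Fin N) ℤ) : Prop :=
  (∀ i j, i < j → M i j = 0) ∧ (∀ j, 0 ≤ M j j) ∧ ∀ i j, j < i → 0 ≤ M i j ∧ M i j < M j j

/-- `Red_N(m)`: the reduced `N × N` matrices of determinant `m`. -/
def redSet (N : ℕ) (m : ℕ+) : Set (Matrix (Fin N) (Fin N) ℤ) :=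
  {M | IsReducedMatrix M ∧ M.det = (m : ℤ)}

end

noncomputable section

/-! ### Dirichlet-type series with non-negative exponents -/

section ExpSeries

variable {ι : Type*} {E : ι → ℝ} {a : ℝ}

/-! Give a zero-cycle of `X_p` the energy `log p · deg α`. Then `P(α)` at `t = p^{-s}` is a
Boltzmann weight at inverse temperature `s`, and the Shannon entropy of a Gibbs distribution is `(1
- s d/ds) log Z` (`gibbs_entropy`). This requires `Z(X_p, t)` to be the partition function `∑_α
t^{deg α}`. That is the Euler product over closed points (`hasSum_pow_degree`), fed by the count of
`𝔽_{p^m}`-points according to the closed point they hit (`hasSum_residueDegree`).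

The only geometric input about the three schemes is `IsPolynomialCount`: over a field with `q`
elements they have `∑_{j ∈ J} q^j` points, with `J = {0}`, `{n}`, `{0, …, n}`. Hence `log Z(X_p,
p^{-s}) = ∑_j -log (1 - p^{-(s-j)})`. Summation over `p`, with termwise differentiation, turns `log
L` into `∑_j log ζ(s - j)` and the local entropies into the global one.

On the physical side, the partition function depends only on the degeneracies, as the Dirichlet
series `∑ D_k k^{-b}` (`hasSum_rpow_level_iff`), so it suffices that this equals `∏_{j ∈ J} ζ(b -
j)`. For reduced matrices the series factors over columns (`PosReducedMatrix.hasSum_level`).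
Existence and uniqueness of the Hermite normal form identify the `GL_{n+1}` states with reduced
matrices. -/

theorem exp_neg_mul_energy_deriv (hE : ∀ x, 0 ≤ E x)
    (h : ∀ b, a < b → Summable fun x => Real.exp (-b * E x)) {b : ℝ} (hb : a < b) :
    (Summable fun x => E x * Real.exp (-b * E x)) ∧
      HasDerivAt (fun b => ∑' x, Real.exp (-b * E x)) (-∑' x, E x * Real.exp (-b * E x)) b := by
  obtain ⟨d, had, hdb⟩ := exists_between hb
  obtain ⟨c, hdc, hcb⟩ := exists_between hdb
  -- With `a < d < c < b`, the factor `E x` is absorbed by `exp ((c - d) * E x)`. The bound is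
  -- uniform in `y > c` and summable, so the series may be differentiated termwise.
  have key : ∀ x y, c < y → E x * Real.exp (-y * E x) ≤ (c - d)⁻¹ * Real.exp (-d * E x) := by
    intro x y hy
    have h0 : 0 < c - d := sub_pos.2 hdc
    have h1 : (c - d) * E x ≤ Real.exp ((c - d) * E x) := by
      linarith [Real.add_one_le_exp ((c - d) * E x)]
    have h2 : Real.exp (-y * E x) ≤ Real.exp (-c * E x) := by
      apply Real.exp_le_exp.2
      nlinarith [hE x]
    rw [inv_mul_eq_div, le_div_iff₀' h0]
    calc (c - d) * (E x * Real.exp (-y * E x))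
        = (c - d) * E x * Real.exp (-y * E x) := by ring
      _ ≤ Real.exp ((c - d) * E x) * Real.exp (-c * E x) := by gcongr
      _ = Real.exp (-d * E x) := by rw [← Real.exp_add]; congr 1; ring
  have hsum := (h d had).mul_left (c - d)⁻¹
  refine ⟨.of_nonneg_of_le (fun x => mul_nonneg (hE x) (Real.exp_pos _).le)
    (fun x => key x b hcb) hsum, ?_⟩
  rw [← tsum_neg]
  refine hasDerivAt_tsum_of_isPreconnected (t := Set.Ioi c)
    (g' := fun x y => -(E x * Real.exp (-y * E x))) hsum isOpen_Ioi isPreconnected_Ioi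
    (fun x y _ => ?_) (fun x y hy => ?_) hcb (h b hb) hcb
  · have := ((hasDerivAt_id y).neg.mul_const (E x)).exp
    convert! this using 1
    simp [mul_comm]
  · rw [norm_neg, Real.norm_of_nonneg (mul_nonneg (hE x) (Real.exp_pos _).le)]
    exact key x y hy

theorem tsum_exp_pos [Nonempty ι] {b : ℝ} (h : Summable fun x => Real.exp (-b * E x)) :
    0 < ∑' x, Real.exp (-b * E x) :=
  h.tsum_pos (fun _ => (Real.exp_pos _).le) (Classical.arbitrary ι) (Real.exp_pos _)

/-- The Shannon entropy of the Gibbs distribution is the thermodynamical entropy. -/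
theorem gibbs_entropy [Nonempty ι] (hE : ∀ x, 0 ≤ E x)
    (h : ∀ b, a < b → Summable fun x => Real.exp (-b * E x)) {b Z : ℝ} (hb : a < b)
    (hZ : Z = ∑' x, Real.exp (-b * E x)) :
    HasSum (fun x => Real.exp (-b * E x) / Z) 1 ∧
    (Summable fun x => Real.exp (-b * E x) / Z * Real.log (Real.exp (-b * E x) / Z)) ∧
    IsOneSubMulDeriv (fun b => Real.log (∑' x, Real.exp (-b * E x))) b
      (∑' x, -(Real.exp (-b * E x) / Z * Real.log (Real.exp (-b * E x) / Z))) := by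
  obtain ⟨hs, hd⟩ := exp_neg_mul_energy_deriv hE h hb
  have hpos : 0 < Z := hZ ▸ tsum_exp_pos (h b hb)
  have hP : HasSum (fun x => Real.exp (-b * E x) / Z) 1 := by
    have := (h b hb).hasSum.div_const Z
    rwa [← hZ, div_self hpos.ne'] at this
  -- The logarithm of a Boltzmann weight is affine in the energy, so the entropy is `b` times the
  -- mean energy plus `log Z`.
  have hterm : ∀ x, Real.exp (-b * E x) / Z * Real.log (Real.exp (-b * E x) / Z) =
      -(b / Z * (E x * Real.exp (-b * E x)) + Real.log Z * (Real.exp (-b * E x) / Z)) := by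
    intro x
    rw [Real.log_div (Real.exp_ne_zero _) hpos.ne', Real.log_exp]
    ring
  have hsum : HasSum (fun x => Real.exp (-b * E x) / Z * Real.log (Real.exp (-b * E x) / Z))
      (-(b / Z * (∑' x, E x * Real.exp (-b * E x)) + Real.log Z * 1)) := by
    simp_rw [hterm]
    exact ((hs.hasSum.mul_left _).add (hP.mul_left _)).neg
  refine ⟨hP, hsum.summable, _, hd.log (hZ ▸ hpos.ne'), ?_⟩
  simp only [hsum.neg.tsum_eq, ← hZ]
  ring

end ExpSeries

/-! ### The logarithm of the Euler product of the Riemann zeta function -/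

/-- `-log (1 - p^{-x})` -/
def eulerLog (p : Nat.Primes) (x : ℝ) : ℝ := -Real.log (1 - (p : ℝ) ^ (-x))

/-- The derivative of `-log (1 - p^{-x})`. -/
def eulerLogDeriv (p : Nat.Primes) (x : ℝ) : ℝ :=
  -(Real.log p * (p : ℝ) ^ (-x) / (1 - (p : ℝ) ^ (-x)))

theorem prime_rpow_neg_lt_one (p : Nat.Primes) {x : ℝ} (hx : 0 < x) : (p : ℝ) ^ (-x) < 1 :=
  Real.rpow_lt_one_of_one_lt_of_neg (by exact_mod_cast p.2.one_lt) (by linarith)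

theorem prime_pos (p : Nat.Primes) : (0 : ℝ) < p := by exact_mod_cast p.2.pos

theorem hasDerivAt_eulerLog (p : Nat.Primes) {x : ℝ} (hx : 0 < x) :
    HasDerivAt (eulerLog p) (eulerLogDeriv p x) x := by
  have h1 : HasDerivAt (fun x : ℝ => (p : ℝ) ^ (-x)) (-((p : ℝ) ^ (-x) * Real.log p)) x := by
    have := (hasDerivAt_neg x).const_rpow (prime_pos p)
    convert! this using 1
    ring
  have h2 := ((h1.const_sub 1).log (sub_pos.2 (prime_rpow_neg_lt_one p hx)).ne').neg
  convert! h2 using 1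
  rw [eulerLogDeriv]
  ring

theorem summable_eulerLog {x : ℝ} (hx : 1 < x) : Summable fun p => eulerLog p x := by
  have h : Summable fun p : Nat.Primes => (p : ℝ) ^ (-x) :=
    Nat.Primes.summable_rpow.2 (by linarith)
  have := Real.summable_log_one_add_of_summable h.neg
  simpa [eulerLog, sub_eq_add_neg] using this.neg

/-- Keeps the denominator of `eulerLogDeriv` at least `1/2`, whence the factor 2 in
`norm_eulerLogDeriv_le`. -/
theorem prime_rpow_neg_le_half (p : Nat.Primes) {x : ℝ} (hx : 1 < x) :
    (p : ℝ) ^ (-x) ≤ 1 / 2 := by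
  have h2 : (2 : ℝ) ≤ p := by exact_mod_cast p.2.two_le
  calc (p : ℝ) ^ (-x) ≤ (p : ℝ) ^ (-1 : ℝ) :=
        Real.rpow_le_rpow_of_exponent_le (by linarith) (by linarith)
    _ = (p : ℝ)⁻¹ := Real.rpow_neg_one _
    _ ≤ 1 / 2 := by rw [one_div]; gcongr

theorem norm_eulerLogDeriv_le (p : Nat.Primes) {c y : ℝ} (hc : 1 < c) (hy : c ≤ y) :
    ‖eulerLogDeriv p y‖ ≤ 2 * (Real.log p * (p : ℝ) ^ (-c)) := by
  have h1 : (1 : ℝ) ≤ p := by exact_mod_cast p.2.one_lt.le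
  have h2 := prime_rpow_neg_le_half p (hc.trans_le hy)
  have h3 : (p : ℝ) ^ (-y) ≤ (p : ℝ) ^ (-c) :=
    Real.rpow_le_rpow_of_exponent_le h1 (by linarith)
  have h4 : 0 ≤ Real.log p := Real.log_nonneg h1
  have h5 : 0 ≤ (p : ℝ) ^ (-y) := (Real.rpow_pos_of_pos (prime_pos p) _).le
  rw [eulerLogDeriv, norm_neg, Real.norm_of_nonneg (by apply div_nonneg <;> [positivity; linarith]),
    div_le_iff₀ (by linarith)]
  have h6 := mul_le_mul_of_nonneg_left h3 h4
  have h7 : 0 ≤ Real.log p * (p : ℝ) ^ (-c) := (mul_nonneg h4 h5).trans h6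
  nlinarith

theorem summable_log_mul_rpow {c : ℝ} (hc : 1 < c) :
    Summable fun p : Nat.Primes => 2 * (Real.log p * (p : ℝ) ^ (-c)) := by
  obtain ⟨d, hd, hdc⟩ := exists_between hc
  have h : Summable fun p : Nat.Primes => (p : ℝ) ^ (-d) :=
    Nat.Primes.summable_rpow.2 (by linarith)
  refine .mul_left _ (.of_nonneg_of_le (fun p => ?_) (fun p => ?_) (h.mul_left (c - d)⁻¹))
  · exact mul_nonneg (Real.log_nonneg (by exact_mod_cast p.2.one_lt.le))
      (Real.rpow_pos_of_pos (prime_pos p) _).le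
  -- Trades `log p` for the small power `p^{c-d}`, leaving the convergent series `∑ p^{-d}` with `d
  -- > 1`.
  · have := Real.log_le_rpow_div (prime_pos p).le (sub_pos.2 hdc)
    calc Real.log p * (p : ℝ) ^ (-c) ≤ (p : ℝ) ^ (c - d) / (c - d) * (p : ℝ) ^ (-c) := by
          gcongr
      _ = (c - d)⁻¹ * ((p : ℝ) ^ (c - d) * (p : ℝ) ^ (-c)) := by ring
      _ = (c - d)⁻¹ * (p : ℝ) ^ (-d) := by
          rw [← Real.rpow_add (prime_pos p)]; congr 2; ring

theorem summable_eulerLogDeriv {x : ℝ} (hx : 1 < x) : Summable fun p => eulerLogDeriv p x :=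
  .of_norm_bounded (summable_log_mul_rpow hx) fun p => norm_eulerLogDeriv_le p hx le_rfl

/-- `log ζ(x)` for `x > 1`, as a sum over the primes. -/
def logZeta (x : ℝ) : ℝ := ∑' p, eulerLog p x

/-- The derivative of `log ζ`. -/
def logZetaDeriv (x : ℝ) : ℝ := ∑' p, eulerLogDeriv p x

theorem hasDerivAt_logZeta {x : ℝ} (hx : 1 < x) : HasDerivAt logZeta (logZetaDeriv x) x := by
  obtain ⟨c, hc, hcx⟩ := exists_between hx
  exact hasDerivAt_tsum_of_isPreconnected (summable_log_mul_rpow hc) isOpen_Ioi isPreconnected_Ioi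
    (fun p y (hy : c < y) => hasDerivAt_eulerLog p (by linarith))
    (fun p y (hy : c < y) => norm_eulerLogDeriv_le p hc hy.le) hcx (summable_eulerLog hx) hcx

theorem exp_eulerLog (p : Nat.Primes) {x : ℝ} (hx : 0 < x) :
    Real.exp (eulerLog p x) = (1 - (p : ℝ) ^ (-x))⁻¹ := by
  rw [eulerLog, Real.exp_neg, Real.exp_log (sub_pos.2 (prime_rpow_neg_lt_one p hx))]

/-- Both sides are limits of the same Euler product. Positivity puts `ζ(x)` in the slit plane, where
the principal logarithm is differentiable. -/
theorem riemannZeta_ofReal_eq_exp {x : ℝ} (hx : 1 < x) :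
    riemannZeta (x : ℂ) = ((Real.exp (logZeta x) : ℝ) : ℂ) := by
  have h1 : HasProd (fun p : Nat.Primes => (1 - (p : ℂ) ^ (-(x : ℂ)))⁻¹) (riemannZeta x) :=
    riemannZeta_eulerProduct_hasProd (by simpa using hx)
  have h2 : HasProd (fun p : Nat.Primes => (Real.exp (eulerLog p x) : ℂ))
      ((Real.exp (logZeta x) : ℝ) : ℂ) :=
    ((summable_eulerLog hx).hasSum.rexp).map Complex.ofRealHom Complex.continuous_ofReal
  refine h1.unique (h2.congr_fun fun p => ?_)
  rw [exp_eulerLog p (by linarith)]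
  push_cast
  rw [Complex.ofReal_cpow (prime_pos p).le]
  simp

/-- The complex derivative exists by holomorphy; restriction to the real line, where the function is
`logZeta`, determines its value. -/
theorem hasDerivAt_clog_riemannZeta {x : ℝ} (hx : 1 < x) :
    HasDerivAt (fun z : ℂ => Complex.log (riemannZeta z)) (logZetaDeriv x : ℂ) (x : ℂ) := by
  have hne : (x : ℂ) ≠ 1 := by exact_mod_cast hx.ne'
  have h1 : HasDerivAt (fun z : ℂ => Complex.log (riemannZeta z))
      (deriv riemannZeta x / riemannZeta x) x := by
    refine (differentiableAt_riemannZeta hne).hasDerivAt.clog ?_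
    rw [riemannZeta_ofReal_eq_exp hx]
    exact Complex.ofReal_mem_slitPlane.2 (Real.exp_pos _)
  have h2 : HasDerivAt (fun y : ℝ => (logZeta y : ℂ)) (logZetaDeriv x : ℂ) x :=
    (hasDerivAt_logZeta hx).ofReal_comp
  have h3 : HasDerivAt (fun y : ℝ => (logZeta y : ℂ)) (deriv riemannZeta x / riemannZeta x) x := by
    refine h1.comp_ofReal.congr_of_eventuallyEq ?_
    filter_upwards [lt_mem_nhds hx] with y hy
    rw [riemannZeta_ofReal_eq_exp hy, ← Complex.ofReal_log (Real.exp_pos _).le, Real.log_exp]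
  rwa [h3.unique h2] at h1

theorem clog_riemannZeta {x : ℝ} (hx : 1 < x) :
    Complex.log (riemannZeta x) = (logZeta x : ℂ) := by
  rw [riemannZeta_ofReal_eq_exp hx, ← Complex.ofReal_log (Real.exp_pos _).le, Real.log_exp]

theorem hasSum_exp_logZeta {x : ℝ} (hx : 1 < x) :
    HasSum (fun k : ℕ+ => (k : ℝ) ^ (-x)) (Real.exp (logZeta x)) := by
  have h1 : Summable fun k : ℕ => 1 / (k : ℝ) ^ x := Real.summable_one_div_nat_rpow.2 hx
  have h2 := zeta_eq_tsum_one_div_nat_cpow (s := x) (by simpa using hx)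
  rw [riemannZeta_ofReal_eq_exp hx] at h2
  have h3 : Real.exp (logZeta x) = ∑' k : ℕ, 1 / (k : ℝ) ^ x := by
    apply Complex.ofReal_injective
    rw [h2, Complex.ofReal_tsum]
    refine tsum_congr fun k => ?_
    push_cast
    rw [Complex.ofReal_cpow k.cast_nonneg]
    simp
  have h4 := h1.hasSum
  rw [← h3] at h4
  have h5 := (Function.Injective.hasSum_iff PNat.coe_injective (f := fun k : ℕ => 1 / (k : ℝ) ^ x)
    (a := Real.exp (logZeta x)) ?_).2 h4
  · refine h5.congr_fun fun k => ?_
    simp [Real.rpow_neg]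
  -- The index 0 contributes nothing, since `1 / 0 ^ x` is `0` for `x ≠ 0`.
  · intro k hk
    have : k = 0 := by
      by_contra hk0
      exact hk ⟨⟨k, Nat.pos_of_ne_zero hk0⟩, rfl⟩
    subst this
    simp [Real.zero_rpow (by linarith : x ≠ 0)]

/-! ### Generating series of finite formal sums -/

section FormalSums

variable {C : Type*}

/-- A formal sum on `insert c S` is uniquely a multiple of `c` plus one on `S`, so each new element
contributes a geometric series. -/
theorem hasSum_prod_pow_of_support_subset {t : C → ℝ} (h0 : ∀ c, 0 ≤ t c) (h1 : ∀ c, t c < 1)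
    (S : Finset C) :
    HasSum (fun α : {α : C →₀ ℕ // α.support ⊆ S} => α.1.prod fun c k => t c ^ k)
      (∏ c ∈ S, (1 - t c)⁻¹) := by
  classical
  induction S using Finset.induction_on with
  | empty =>
    have : Unique {α : C →₀ ℕ // α.support ⊆ ∅} :=
      { default := ⟨0, by simp⟩
        uniq := fun α => Subtype.ext (by simpa using α.2) }
    have h : (default : {α : C →₀ ℕ // α.support ⊆ ∅}).1 = 0 := by
      simpa using (default : {α : C →₀ ℕ // α.support ⊆ ∅}).2
    convert! hasSum_unique _ using 1
    rw [h]
    simp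
  | insert c S hc ih =>
    let φ : ℕ × {α : C →₀ ℕ // α.support ⊆ S} → {α : C →₀ ℕ // α.support ⊆ insert c S} :=
      fun x => ⟨Finsupp.single c x.1 + x.2.1, by
        refine Finsupp.support_add.trans (Finset.union_subset ?_ ?_)
        · exact Finsupp.support_single_subset.trans (by simp)
        · exact x.2.2.trans (Finset.subset_insert _ _)⟩
    have hzero : ∀ α : {α : C →₀ ℕ // α.support ⊆ S}, α.1 c = 0 := fun α => by
      by_contra h
      exact hc (α.2 (Finsupp.mem_support_iff.2 h))
    have hφ : Function.Bijective φ := by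
      constructor
      · rintro ⟨k, α⟩ ⟨l, β⟩ h
        have h' : Finsupp.single c k + α.1 = Finsupp.single c l + β.1 := congrArg Subtype.val h
        have hkl : k = l := by
          have := DFunLike.congr_fun h' c
          simpa [hzero] using this
        subst hkl
        rw [Subtype.ext (add_left_cancel h')]
      · intro α
        refine ⟨⟨α.1 c, ⟨α.1.erase c, ?_⟩⟩, Subtype.ext (Finsupp.single_add_erase c α.1)⟩
        rw [Finsupp.support_erase]
        intro x hx
        rw [Finset.mem_erase] at hx
        exact (Finset.mem_insert.1 (α.2 hx.2)).resolve_left hx.1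
    rw [← (Equiv.ofBijective φ hφ).hasSum_iff, Finset.prod_insert hc]
    have hg := hasSum_geometric_of_lt_one (h0 c) (h1 c)
    have := hg.mul ih (hg.summable.mul_of_nonneg ih.summable (fun k => pow_nonneg (h0 c) k)
      (fun α => Finset.prod_nonneg fun c _ => pow_nonneg (h0 c) _))
    refine this.congr_fun fun x => ?_
    simp only [Function.comp, Equiv.ofBijective_apply, φ]
    rw [Finsupp.prod_add_index' (by simp) (by simp [pow_add]), Finsupp.prod_single_index (by simp)]

/-- All terms are nonnegative, so the sum is a least upper bound. Finitely many formal sums share a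
finite support `S`, whose product is at most `exp G`; conversely any upper bound dominates every
finite product, and these tend to `exp G`. -/
theorem hasSum_prod_pow_formalSum {t : C → ℝ} (h0 : ∀ c, 0 ≤ t c) (h1 : ∀ c, t c < 1) {G : ℝ}
    (hG : HasSum (fun c => -Real.log (1 - t c)) G) :
    HasSum (fun α : C →₀ ℕ => α.prod fun c k => t c ^ k) (Real.exp G) := by
  classical
  have hw : ∀ α : C →₀ ℕ, 0 ≤ α.prod fun c k => t c ^ k :=
    fun α => Finset.prod_nonneg fun c _ => pow_nonneg (h0 c) _
  have hg : ∀ c, 0 ≤ -Real.log (1 - t c) := fun c =>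
    neg_nonneg.2 (Real.log_nonpos (by linarith [h1 c]) (by linarith [h0 c]))
  have hexp : ∀ S : Finset C,
      ∏ c ∈ S, (1 - t c)⁻¹ = Real.exp (∑ c ∈ S, -Real.log (1 - t c)) := by
    intro S
    rw [Real.exp_sum]
    refine Finset.prod_congr rfl fun c _ => ?_
    rw [Real.exp_neg, Real.exp_log (sub_pos.2 (h1 c))]
  have hfin := hasSum_prod_pow_of_support_subset h0 h1
  refine hasSum_of_isLUB_of_nonneg _ hw ⟨?_, fun u hu => ?_⟩
  · rintro _ ⟨T, rfl⟩
    let S := T.biUnion Finsupp.support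
    have hT : ∀ α ∈ T, α.support ⊆ S := fun α hα => Finset.subset_biUnion_of_mem _ hα
    calc ∑ α ∈ T, (α.prod fun c k => t c ^ k)
        = ∑ α ∈ T.subtype (fun α => α.support ⊆ S), (α.1.prod fun c k => t c ^ k) :=
          (Finset.sum_subtype_of_mem _ hT).symm
      _ ≤ ∏ c ∈ S, (1 - t c)⁻¹ := sum_le_hasSum _ (fun α _ => hw α.1) (hfin S)
      _ ≤ Real.exp G := by
          rw [hexp]
          exact Real.exp_le_exp.2 (sum_le_hasSum _ (fun c _ => hg c) hG)
  · refine le_of_tendsto' ((Real.continuous_exp.tendsto _).comp hG) fun S => ?_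
    rw [Function.comp, ← hexp]
    refine hasSum_le_of_sum_le (hfin S) fun T => ?_
    refine le_trans (le_of_eq ?_) (hu ⟨T.map (Function.Embedding.subtype _), rfl⟩)
    simp

/-- The logarithm of an Euler factor, as a series over the multiples of the degree. -/
theorem hasSum_pow_of_dvd {d : ℕ} (hd : 0 < d) {t : ℝ} (h0 : 0 ≤ t) (h1 : t < 1) :
    HasSum (fun m : ℕ => (if d ∣ m + 1 then (d : ℝ) else 0) * t ^ (m + 1) / ((m + 1 : ℕ) : ℝ))
      (-Real.log (1 - t ^ d)) := by
  have hlt : |t ^ d| < 1 := by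
    rw [abs_of_nonneg (pow_nonneg h0 d)]
    exact pow_lt_one₀ h0 h1 hd.ne'
  have hlog := Real.hasSum_pow_div_log_of_abs_lt_one hlt
  have hsub : ∀ k : ℕ, d * (k + 1) - 1 + 1 = d * (k + 1) := fun k =>
    Nat.sub_add_cancel (Nat.mul_pos hd k.succ_pos)
  -- Only exponents `m + 1 = d * (k + 1)` survive; as `m` starts at 0, they sit at index `d * (k +
  -- 1) - 1`.
  have hinj : Function.Injective fun k : ℕ => d * (k + 1) - 1 := by
    intro k l h
    have h' : d * (k + 1) = d * (l + 1) := by rw [← hsub k, ← hsub l]; exact congrArg (· + 1) h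
    exact Nat.succ_injective (Nat.eq_of_mul_eq_mul_left hd h')
  refine (hinj.hasSum_iff ?_).1 (hlog.congr_fun fun k => ?_)
  · intro m hm
    rw [if_neg]
    · simp
    · rintro ⟨k, hk⟩
      have hk0 : k ≠ 0 := by rintro rfl; simp at hk
      refine hm ⟨k - 1, ?_⟩
      have : d * (k - 1 + 1) = m + 1 := by rw [Nat.sub_add_cancel (Nat.pos_of_ne_zero hk0), hk]
      simp only [this, Nat.add_sub_cancel]
  · simp only [Function.comp, hsub]
    rw [if_pos (dvd_mul_right _ _), pow_mul]
    have : (d : ℝ) ≠ 0 := by exact_mod_cast hd.ne'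
    push_cast
    field_simp

/-- The generating series of the degree on finite formal sums, in terms of the numbers
`N m = ∑_{deg c ∣ m} deg c`. -/
theorem hasSum_pow_degree {deg : C → ℕ} (hdeg : ∀ c, 0 < deg c) {N : ℕ → ℝ}
    (hN : ∀ m, 0 < m → HasSum (fun c => if deg c ∣ m then (deg c : ℝ) else 0) (N m))
    {t : ℝ} (h0 : 0 ≤ t) (h1 : t < 1)
    (hs : Summable fun m : ℕ => N (m + 1) * t ^ (m + 1) / ((m + 1 : ℕ) : ℝ)) :
    HasSum (fun α : C →₀ ℕ => t ^ (α.sum fun c k => k * deg c))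
      (Real.exp (∑' m : ℕ, N (m + 1) * t ^ (m + 1) / ((m + 1 : ℕ) : ℝ))) := by
  -- A nonnegative double array: summing over `c` gives the zeta series, summing over `m` gives the
  -- logarithms of the Euler factors.
  let f : ℕ × C → ℝ := fun x =>
    (if deg x.2 ∣ x.1 + 1 then (deg x.2 : ℝ) else 0) * t ^ (x.1 + 1) / ((x.1 + 1 : ℕ) : ℝ)
  have hf0 : 0 ≤ f := fun x => by
    have : (0 : ℝ) ≤ if deg x.2 ∣ x.1 + 1 then (deg x.2 : ℝ) else 0 := by split_ifs <;> positivity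
    exact div_nonneg (mul_nonneg this (pow_nonneg h0 _)) (Nat.cast_nonneg _)
  have hrow : ∀ m, HasSum (fun c => f (m, c)) (N (m + 1) * t ^ (m + 1) / ((m + 1 : ℕ) : ℝ)) :=
    fun m => ((hN (m + 1) m.succ_pos).mul_right _).div_const _
  have hfs : Summable f :=
    (summable_prod_of_nonneg hf0).2 ⟨fun m => (hrow m).summable, by simpa [(hrow _).tsum_eq] using hs⟩
  have hcol : ∀ c, HasSum (fun m => f (m, c)) (-Real.log (1 - t ^ deg c)) :=
    fun c => hasSum_pow_of_dvd (hdeg c) h0 h1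
  have hG : HasSum (fun c => -Real.log (1 - t ^ deg c))
      (∑' m : ℕ, N (m + 1) * t ^ (m + 1) / ((m + 1 : ℕ) : ℝ)) := by
    have h2 := hfs.hasSum.prod_fiberwise hrow
    rw [h2.tsum_eq]
    exact ((Equiv.prodComm C ℕ).hasSum_iff.2 hfs.hasSum).prod_fiberwise hcol
  refine (hasSum_prod_pow_formalSum (fun c => pow_nonneg h0 _)
    (fun c => pow_lt_one₀ h0 h1 (hdeg c).ne') hG).congr_fun fun α => ?_
  rw [Finsupp.sum, Finsupp.prod, ← Finset.prod_pow_eq_pow_sum]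
  refine Finset.prod_congr rfl fun c _ => ?_
  rw [← pow_mul, mul_comm]

end FormalSums

/-! ### Closed points and rational points of a scheme locally of finite type over `𝔽_p` -/

/-- A ring has at most one `𝔽_p`-structure, so compatibility over `Spec 𝔽_p` is automatic. -/
theorem Spec_hom_zmod_ext {p : ℕ} {R : CommRingCat.{0}} (g h : Spec R ⟶ Spec (CommRingCat.of (ZMod p))) :
    g = h := by
  rw [← Spec.map_preimage g, ← Spec.map_preimage h]
  congr 1
  ext1
  exact Subsingleton.elim _ _

section SchemeOverFiniteField

variable {p : ℕ} [Fact p.Prime]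

/-- Every ring homomorphism is `𝔽_p`-linear, and a field of degree `d` embeds in `𝔽_{p^m}` in `d`
ways or not at all. If `κ` has infinite degree, `finrank` is 0, which does not divide `m > 0`. -/
theorem natCard_ringHom_galoisField (κ : Type) [Field κ] (φ : ZMod p →+* κ) {m : ℕ} (hm : 0 < m) :
    Nat.card (κ →+* GaloisField p m) =
      letI := φ.toAlgebra
      if Module.finrank (ZMod p) κ ∣ m then Module.finrank (ZMod p) κ else 0 := by
  let := φ.toAlgebra
  have : NeZero m := ⟨hm.ne'⟩
  let e : (κ →+* GaloisField p m) ≃ (κ →ₐ[ZMod p] GaloisField p m) :=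
    { toFun g := 
        { toRingHom := g
          commutes' := fun r => RingHom.congr_fun
            (Subsingleton.elim (g.comp (algebraMap (ZMod p) κ)) (algebraMap _ _)) r }
      invFun g := g.toRingHom
      left_inv _ := rfl
      right_inv _ := rfl }
  have hfin : Module.finrank (ZMod p) (GaloisField p m) = m := GaloisField.finrank p hm.ne'
  rw [Nat.card_congr e]
  split_ifs with h
  · exact FiniteField.natCard_algHom_of_finrank_dvd (hfin.symm ▸ h)
  · have := mt (FiniteField.nonempty_algHom_iff_finrank_dvd (F := ZMod p) (K := κ)
      (L := GaloisField p m)).1 (hfin.symm ▸ h)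
    rw [not_nonempty_iff] at this
    exact Nat.card_of_isEmpty

variable {X : Scheme.{0}} (f : X ⟶ Spec (CommRingCat.of (ZMod p)))

/-- The structure map `𝔽_p → κ(x)`. -/
def residueFieldStructureMap (x : X) : ZMod p →+* X.residueField x :=
  (Spec.preimage (X.fromSpecResidueField x ≫ f)).hom

/-- `residueDegree` is taken over the residue field of the image point; that field is `𝔽_p` itself,
because the ideal is maximal with surjective residue map. -/
theorem residueDegree_eq_finrank (x : X) :
    f.residueDegree x = letI := (residueFieldStructureMap f x).toAlgebra
      Module.finrank (ZMod p) (X.residueField x) := by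
  let y : Spec (CommRingCat.of (ZMod p)) := f x
  let I : Ideal (ZMod p) := y.asIdeal
  have hprime : I.IsPrime := y.2
  have hmax : I.IsMaximal := hprime.isMaximal'
  let e : I.ResidueField ≃+* (Spec (CommRingCat.of (ZMod p))).residueField y :=
    (Scheme.Spec.residueFieldIso _ y).symm.commRingCatIsoToRingEquiv
  let σ := e.toRingHom.comp (algebraMap (ZMod p) I.ResidueField)
  have hσ : Function.Bijective σ :=
    ⟨σ.injective, e.surjective.comp I.algebraMap_residueField_surjective⟩
  let := (residueFieldStructureMap f x).toAlgebra
  let := (f.residueFieldMap x).hom.toAlgebra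
  exact (Algebra.finrank_eq_of_equiv_equiv (RingEquiv.ofBijective σ hσ) (RingEquiv.refl _)
    (Subsingleton.elim _ _)).symm

/-- On a Jacobson scheme, `x` is closed exactly when `Spec κ(x) ⟶ X` is locally of finite type; over
a field this means that `κ(x)` is finite. -/
theorem isClosed_singleton_iff_finite [LocallyOfFiniteType f] (x : X) :
    IsClosed {x} ↔ (residueFieldStructureMap f x).Finite := by
  have : JacobsonSpace X := LocallyOfFiniteType.jacobsonSpace f
  have h : (residueFieldStructureMap f x).Finite ↔ IsFinite (X.fromSpecResidueField x ≫ f) := by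
    rw [← Spec.map_preimage (X.fromSpecResidueField x ≫ f), IsFinite.SpecMap_iff]
    rfl
  rw [h]
  constructor
  · intro hx
    have := isClosed_singleton_iff_isClosedImmersion.1 hx
    exact (isFinite_iff_locallyOfFiniteType_of_jacobsonSpace
      (f := X.fromSpecResidueField x ≫ f)).2 inferInstance
  · intro hx
    rw [isClosed_singleton_iff_locallyOfFiniteType]
    exact locallyOfFiniteType_of_comp (X.fromSpecResidueField x) f

theorem residueDegree_pos [LocallyOfFiniteType f] {x : X} (hx : IsClosed {x}) :
    0 < f.residueDegree x := by
  rw [residueDegree_eq_finrank]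
  let := (residueFieldStructureMap f x).toAlgebra
  have : Module.Finite (ZMod p) (X.residueField x) := (isClosed_singleton_iff_finite f x).1 hx
  exact Module.finrank_pos

/-- The `𝔽_{p^m}`-valued points over `𝔽_p` are all the morphisms from `Spec 𝔽_{p^m}`. -/
def pointsEquivHom (m : ℕ) :
    {g : Spec (CommRingCat.of (GaloisField p m)) ⟶ X //
      g ≫ f = Spec.map (CommRingCat.ofHom (algebraMap (ZMod p) (GaloisField p m)))} ≃
    (Spec (CommRingCat.of (GaloisField p m)) ⟶ X) :=
  Equiv.subtypeUnivEquiv fun _ => Spec_hom_zmod_ext _ _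

theorem hasSum_residueDegree [LocallyOfFiniteType f] {m : ℕ} (hm : 0 < m)
    (hfin : Finite (Spec (CommRingCat.of (GaloisField p m)) ⟶ X)) :
    HasSum (fun x : {x : X // IsClosed ({x} : Set X)} =>
      if f.residueDegree x.1 ∣ m then (f.residueDegree x.1 : ℝ) else 0) (pointCount p f m) := by
  let K := CommRingCat.of (GaloisField p m)
  have : NeZero m := ⟨hm.ne'⟩
  have hK : Finite (GaloisField p m) := inferInstance
  let T := Σ x : X, (X.residueField x ⟶ K)
  let e : (Spec K ⟶ X) ≃ T := Scheme.SpecToEquivOfField _ X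
  have : Finite T := Finite.of_equiv _ e
  have hcount : pointCount p f m = Nat.card T :=
    (Nat.card_congr (pointsEquivHom f m)).trans (Nat.card_congr e)
  have hfib : ∀ x : X, Nat.card (X.residueField x ⟶ K) =
      if f.residueDegree x ∣ m then f.residueDegree x else 0 := by
    intro x
    rw [residueDegree_eq_finrank,
      ← natCard_ringHom_galoisField _ (residueFieldStructureMap f x) hm]
    exact Nat.card_congr
      { toFun g := g.hom
        invFun g := CommRingCat.ofHom g
        left_inv _ := rfl
        right_inv _ := rfl }
  have hfinite : ∀ x : X, Finite (X.residueField x ⟶ K) := fun x =>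
    Finite.of_injective (fun g => (⟨x, g⟩ : T)) fun g h hgh => by simpa using hgh
  have hT : HasSum (fun _ : T => (1 : ℝ)) (Nat.card T) := by
    have := Fintype.ofFinite T
    rw [Nat.card_eq_fintype_card]
    simpa using hasSum_fintype fun _ : T => (1 : ℝ)
  have hX : HasSum (fun x : X => if f.residueDegree x ∣ m then (f.residueDegree x : ℝ) else 0)
      (Nat.card T) := by
    refine hT.sigma fun x => ?_
    have h1 := hfib x
    have := hfinite x
    have := Fintype.ofFinite (X.residueField x ⟶ K)
    have h2 : (if f.residueDegree x ∣ m then (f.residueDegree x : ℝ) else 0) =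
        Nat.card (X.residueField x ⟶ K) := by
      rw [h1]; push_cast; rfl
    rw [h2, Nat.card_eq_fintype_card]
    simpa using hasSum_fintype fun _ : X.residueField x ⟶ K => (1 : ℝ)
  rw [hcount]
  refine (Function.Injective.hasSum_iff Subtype.val_injective fun x hx => ?_).2 hX
  -- An embedding into a finite field makes `κ(x)` finite and hence `x` closed, so the other points
  -- contribute 0.
  have hempty : IsEmpty (X.residueField x ⟶ K) := by
    refine ⟨fun g => hx ⟨⟨x, ?_⟩, rfl⟩⟩
    rw [isClosed_singleton_iff_finite f]
    have : Finite (X.residueField x) :=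
      Finite.of_injective (fun a : X.residueField x => (g.hom a : GaloisField p m)) g.hom.injective
    let := (residueFieldStructureMap f x).toAlgebra
    exact (inferInstance : Module.Finite (ZMod p) (X.residueField x))
  have := hfib x
  rw [Nat.card_of_isEmpty] at this
  split_ifs with h
  · rw [if_pos h] at this
    exact_mod_cast this.symm
  · rfl

end SchemeOverFiniteField

/-! ### Points of the reductions of a scheme over `ℤ` -/

section Reduction

/-- The points of `X_p` with values in a ring of characteristic `p` are those of `X`. -/
def reductionPointsEquiv (X : Scheme.{0}) (p : Nat.Primes) (K : Type) [CommRing K]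
    [Algebra (ZMod p) K] :
    (Spec (CommRingCat.of K) ⟶ pullback (specZIsTerminal.from X)
      (Spec.map (CommRingCat.ofHom (Int.castRingHom (ZMod p))))) ≃
    (Spec (CommRingCat.of K) ⟶ X) where
  toFun g := g ≫ pullback.fst _ _
  invFun h := pullback.lift h (Spec.map (CommRingCat.ofHom (algebraMap (ZMod p) K)))
    (specZIsTerminal.hom_ext _ _)
  left_inv g := by
    apply pullback.hom_ext
    · exact pullback.lift_fst _ _ _
    · exact Spec_hom_zmod_ext _ _
  right_inv h := pullback.lift_fst _ _ _

theorem locallyOfFiniteType_reductionMod (X : Scheme.{0}) (p : Nat.Primes)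
    (g : X ⟶ Spec (CommRingCat.of ℤ)) [LocallyOfFiniteType g] :
    LocallyOfFiniteType (reductionMod X p) := by
  obtain rfl : g = specZIsTerminal.from X := specZIsTerminal.hom_ext _ _
  unfold reductionMod
  infer_instance

/-- `X` is of finite type over `ℤ`, and for all prime powers `q` it has `∑_{j ∈ J} q^j` points over
the field with `q` elements. -/
structure IsPolynomialCount (X : Scheme.{0}) (J : Finset ℕ) : Prop where
  locallyOfFiniteType : LocallyOfFiniteType (specZIsTerminal.from X)
  finite_hom (K : Type) [Field K] [Finite K] : Finite (Spec (CommRingCat.of K) ⟶ X)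
  natCard_hom (K : Type) [Field K] [Finite K] :
    Nat.card (Spec (CommRingCat.of K) ⟶ X) = ∑ j ∈ J, Nat.card K ^ j

theorem isPolynomialCount_specZ : IsPolynomialCount (Spec (CommRingCat.of ℤ)) {0} where
  locallyOfFiniteType := by
    rw [specZIsTerminal.hom_ext (specZIsTerminal.from _) (𝟙 _)]
    infer_instance
  finite_hom K _ _ := by
    have : Unique (Spec (CommRingCat.of K) ⟶ Spec (CommRingCat.of ℤ)) :=
      ⟨⟨specZIsTerminal.from _⟩, fun _ => specZIsTerminal.hom_ext _ _⟩
    infer_instance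
  natCard_hom K _ _ := by
    have : Unique (Spec (CommRingCat.of K) ⟶ Spec (CommRingCat.of ℤ)) :=
      ⟨⟨specZIsTerminal.from _⟩, fun _ => specZIsTerminal.hom_ext _ _⟩
    simp

/-- Affine space is the spectrum of a polynomial ring. -/
def affineSpaceIso (n : ℕ) :
    affineSpaceZ n ≅ Spec (CommRingCat.of (MvPolynomial (Fin n) ℤ)) :=
  AffineSpace.SpecIso (Fin n) (CommRingCat.of ℤ)

/-- The points of affine space with values in a ring `K` are the vectors over `K`. -/
def affineSpacePointsEquiv (n : ℕ) (K : Type) [CommRing K] :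
    (Spec (CommRingCat.of K) ⟶ affineSpaceZ n) ≃ (Fin n → K) where
  toFun g i := (Spec.preimage (g ≫ (affineSpaceIso n).hom)).hom
    (MvPolynomial.X i)
  invFun v := Spec.map (CommRingCat.ofHom (MvPolynomial.eval₂Hom (Int.castRingHom K) v)) ≫
    (affineSpaceIso n).inv
  left_inv g := by
    dsimp only
    rw [Iso.comp_inv_eq, ← Spec.map_preimage (g ≫ _)]
    congr 1
    ext1
    apply MvPolynomial.ringHom_ext
    · intro r
      simp
    · intro i
      simp
  right_inv v := by
    funext i
    simp

theorem isPolynomialCount_affineSpaceZ (n : ℕ) : IsPolynomialCount (affineSpaceZ n) {n} where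
  locallyOfFiniteType := by
    rw [specZIsTerminal.hom_ext (specZIsTerminal.from _)
      ((affineSpaceIso n).hom ≫ Spec.map (CommRingCat.ofHom (algebraMap ℤ _)))]
    have : LocallyOfFiniteType
        (Spec.map (CommRingCat.ofHom (algebraMap ℤ (MvPolynomial (Fin n) ℤ)))) := by
      rw [HasRingHomProperty.Spec_iff (P := @LocallyOfFiniteType)]
      exact RingHom.finiteType_algebraMap.2 inferInstance
    infer_instance
  finite_hom K _ _ := Finite.of_equiv _ (affineSpacePointsEquiv n K).symm
  natCard_hom K _ _ := by
    rw [Nat.card_congr (affineSpacePointsEquiv n K), Nat.card_fun]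
    simp

end Reduction

/-! ### Points of projective space -/

section ProjectiveSpace

attribute [local instance] MvPolynomial.gradedAlgebra

open HomogeneousLocalization

variable {n : ℕ}

/-- The grading of the homogeneous coordinate ring of `ℙⁿ`. -/
abbrev coordGrading (n : ℕ) : ℕ → Submodule ℤ (MvPolynomial (Fin (n + 1)) ℤ) :=
  MvPolynomial.homogeneousSubmodule (Fin (n + 1)) ℤ

theorem X_mem_coordGrading (i : Fin (n + 1)) : MvPolynomial.X i ∈ coordGrading n 1 :=
  MvPolynomial.isHomogeneous_X _ _

/-- The chart `x_i ≠ 0` of `ℙⁿ`. -/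
abbrev coordChart (i : Fin (n + 1)) :
    Spec (CommRingCat.of (Away (coordGrading n) (MvPolynomial.X i))) ⟶ Proj (coordGrading n) :=
  Proj.awayι (coordGrading n) (MvPolynomial.X i) (X_mem_coordGrading i) one_pos

/-- The open subscheme `x_i ≠ 0` of `ℙⁿ`. -/
abbrev coordOpen (i : Fin (n + 1)) : (Proj (coordGrading n)).Opens :=
  Proj.basicOpen (coordGrading n) (MvPolynomial.X i)

/-- The function `x_j / x_i` on the chart `x_i ≠ 0`. -/
def coordRatio (i j : Fin (n + 1)) : Away (coordGrading n) (MvPolynomial.X i) :=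
  Away.isLocalizationElem (X_mem_coordGrading i) (X_mem_coordGrading j)

/-- Serves twice: the charts `x_i ≠ 0` cover `ℙⁿ`, and `Proj` is of finite type over the degree-zero
part. -/
theorem adjoin_X_coordGrading :
    Algebra.adjoin (coordGrading n 0)
      (Set.range (MvPolynomial.X : Fin (n + 1) → MvPolynomial (Fin (n + 1)) ℤ)) = ⊤ := by
  rw [eq_top_iff]
  intro x _
  have hx : x ∈ Algebra.adjoin ℤ (Set.range (MvPolynomial.X : Fin (n + 1) → _)) := by
    rw [MvPolynomial.adjoin_range_X]; trivial
  induction hx using Algebra.adjoin_induction with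
  | mem x hx => exact Algebra.subset_adjoin hx
  | algebraMap r => exact intCast_mem _ r
  | add x y _ _ hx hy => exact add_mem (hx trivial) (hy trivial)
  | mul x y _ _ hx hy => exact mul_mem (hx trivial) (hy trivial)

theorem iSup_coordOpen : ⨆ i, coordOpen (n := n) i = ⊤ :=
  Proj.iSup_basicOpen_eq_top' _ _ (fun i => ⟨1, X_mem_coordGrading i⟩) adjoin_X_coordGrading

/-- The point of the spectrum of a field. -/
def fieldPoint (K : Type) [Field K] : Spec (CommRingCat.of K) := IsLocalRing.closedPoint K

variable {K : Type} [Field K]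

/-- Evaluation of the functions on the chart `x_i ≠ 0` at a vector with `v i ≠ 0`. -/
def chartEval (i : Fin (n + 1)) (v : Fin (n + 1) → K) (hv : v i ≠ 0) :
    Away (coordGrading n) (MvPolynomial.X i) →+* K :=
  (IsLocalization.Away.lift (S := Localization.Away (MvPolynomial.X i : MvPolynomial (Fin (n + 1)) ℤ))
    (MvPolynomial.X i) (g := MvPolynomial.eval₂Hom (Int.castRingHom K) v) (by simpa using hv)).comp
    (algebraMap (Away (coordGrading n) (MvPolynomial.X i)) (Localization.Away _))

theorem chartEval_mk (i : Fin (n + 1)) (v : Fin (n + 1) → K) (hv : v i ≠ 0) (k : ℕ)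
    (f : MvPolynomial (Fin (n + 1)) ℤ) (hf : f ∈ coordGrading n (k • 1)) :
    chartEval i v hv (Away.mk _ (X_mem_coordGrading i) k f hf) =
      MvPolynomial.eval₂Hom (Int.castRingHom K) v f / v i ^ k := by
  rw [chartEval, RingHom.comp_apply, HomogeneousLocalization.algebraMap_apply, Away.val_mk,
    Localization.mk_eq_mk', eq_div_iff (pow_ne_zero _ hv)]
  have := IsLocalization.mk'_spec (Localization.Away (MvPolynomial.X i : MvPolynomial (Fin (n + 1)) ℤ))
    f (⟨MvPolynomial.X i ^ k, k, rfl⟩ : Submonoid.powers _)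
  have h2 := congrArg (IsLocalization.Away.lift
    (S := Localization.Away (MvPolynomial.X i : MvPolynomial (Fin (n + 1)) ℤ))
    (MvPolynomial.X i) (g := MvPolynomial.eval₂Hom (Int.castRingHom K) v) (by simpa using hv)) this
  rw [map_mul, IsLocalization.Away.lift_eq, IsLocalization.Away.lift_eq] at h2
  simpa using h2


theorem chartEval_coordRatio (i j : Fin (n + 1)) (v : Fin (n + 1) → K) (hv : v i ≠ 0) :
    chartEval i v hv (coordRatio i j) = v j / v i := by
  rw [coordRatio, Away.isLocalizationElem, chartEval_mk]
  simp

/-- Division of the coordinates by `x_i`. -/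
def dehomogenize (i : Fin (n + 1)) :
    MvPolynomial (Fin (n + 1)) ℤ →+* Away (coordGrading n) (MvPolynomial.X i) :=
  MvPolynomial.eval₂Hom (Int.castRingHom _) (coordRatio i)

theorem eval₂Hom_smul_of_isHomogeneous {σ R : Type*} [CommRing R] {f : MvPolynomial σ ℤ} {k : ℕ}
    (hf : f.IsHomogeneous k) (c : R) (w : σ → R) :
    MvPolynomial.eval₂Hom (Int.castRingHom R) (fun j => c * w j) f =
      c ^ k * MvPolynomial.eval₂Hom (Int.castRingHom R) w f := by
  simp only [MvPolynomial.coe_eval₂Hom, MvPolynomial.eval₂_eq, Finset.mul_sum]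
  refine Finset.sum_congr rfl fun d hd => ?_
  have hdeg : ∑ i ∈ d.support, d i = k := by
    have := hf (MvPolynomial.mem_support_iff.1 hd)
    simpa [Finsupp.weight_apply, Finsupp.sum] using this
  simp only [mul_pow, Finset.prod_mul_distrib, Finset.prod_pow_eq_pow_sum, hdeg]
  ring

/-- Homogeneity gives `f(x) = x_i^k f(x / x_i)` in the localization, where `x_i` is invertible. So a
homomorphism out of the chart ring is determined by the ratios `x_j / x_i`. -/
theorem dehomogenize_eq_mk (i : Fin (n + 1)) (k : ℕ) (f : MvPolynomial (Fin (n + 1)) ℤ)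
    (hf : f ∈ coordGrading n (k • 1)) :
    dehomogenize i f = Away.mk _ (X_mem_coordGrading i) k f hf := by
  apply HomogeneousLocalization.val_injective
  let L := Localization.Away (MvPolynomial.X i : MvPolynomial (Fin (n + 1)) ℤ)
  let ι : MvPolynomial (Fin (n + 1)) ℤ →+* L := algebraMap _ _
  let θ : Away (coordGrading n) (MvPolynomial.X i) →+* L := algebraMap _ _
  have hθ : ∀ a, θ a = a.val := fun _ => rfl
  have hratio : ∀ j, ι (MvPolynomial.X i) * θ (coordRatio i j) = ι (MvPolynomial.X j) := by
    intro j
    rw [hθ, coordRatio, Away.isLocalizationElem, Away.val_mk, Localization.mk_eq_mk']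
    have h : ι (MvPolynomial.X i) = ι (MvPolynomial.X i ^ 1) := by rw [pow_one]
    rw [h]
    exact (IsLocalization.mk'_spec' L (MvPolynomial.X j ^ 1 : MvPolynomial (Fin (n + 1)) ℤ)
      (⟨MvPolynomial.X i ^ 1, 1, rfl⟩ : Submonoid.powers _)).trans (by rw [pow_one])
  have hf' : f.IsHomogeneous k := by simpa using hf
  have h1 : ι f = ι (MvPolynomial.X i) ^ k * θ (dehomogenize i f) := by
    have h2 : θ (dehomogenize i f) =
        MvPolynomial.eval₂Hom (Int.castRingHom L) (fun j => θ (coordRatio i j)) f := by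
      have : θ.comp (dehomogenize i) =
          MvPolynomial.eval₂Hom (Int.castRingHom L) (fun j => θ (coordRatio i j)) := by
        apply MvPolynomial.ringHom_ext
        · intro r; simp
        · intro j; simp [dehomogenize]
      exact RingHom.congr_fun this f
    have h3 : ι = MvPolynomial.eval₂Hom (Int.castRingHom L) (fun j => ι (MvPolynomial.X j)) := by
      apply MvPolynomial.ringHom_ext
      · intro r; simp
      · intro j; simp
    rw [h2, ← eval₂Hom_smul_of_isHomogeneous hf']
    simp only [hratio]
    exact RingHom.congr_fun h3 f
  rw [← hθ, Away.val_mk, Localization.mk_eq_mk', eq_comm, IsLocalization.mk'_eq_iff_eq_mul]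
  change ι f = _ * ι (MvPolynomial.X i ^ k)
  rw [h1, map_pow, mul_comm]

theorem eq_chartEval (i : Fin (n + 1)) (φ : Away (coordGrading n) (MvPolynomial.X i) →+* K) :
    ∃ (v : Fin (n + 1) → K) (hv : v i = 1), φ = chartEval i v (hv ▸ one_ne_zero) := by
  have hone : coordRatio i i = 1 := by
    apply HomogeneousLocalization.val_injective
    rw [coordRatio, Away.isLocalizationElem, Away.val_mk, HomogeneousLocalization.val_one]
    exact Localization.mk_self (⟨MvPolynomial.X i ^ 1, 1, rfl⟩ :
      Submonoid.powers (MvPolynomial.X i : MvPolynomial (Fin (n + 1)) ℤ))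
  have hv : φ (coordRatio i i) = 1 := by rw [hone, map_one]
  refine ⟨fun j => φ (coordRatio i j), hv, ?_⟩
  have hcomp : φ.comp (dehomogenize i) =
      MvPolynomial.eval₂Hom (Int.castRingHom K) fun j => φ (coordRatio i j) := by
    apply MvPolynomial.ringHom_ext
    · intro r; simp
    · intro j; simp [dehomogenize]
  ext x
  obtain ⟨k, f, hf, rfl⟩ := Away.mk_surjective (coordGrading n) (X_mem_coordGrading i) x
  rw [chartEval_mk, hv, one_pow, div_one, ← hcomp, RingHom.comp_apply,
    dehomogenize_eq_mk i k f hf]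

/-- The `K`-point of `ℙⁿ` with homogeneous coordinates `v`. -/
def projPoint (i : Fin (n + 1)) (v : Fin (n + 1) → K) (hv : v i ≠ 0) :
    Spec (CommRingCat.of K) ⟶ Proj (coordGrading n) :=
  Spec.map (CommRingCat.ofHom (chartEval i v hv)) ≫ coordChart i

/-- Inside chart `i`, the open `x_j ≠ 0` is where `x_j / x_i` is invertible, and that function takes
the value `v j / v i`. -/
theorem projPoint_mem_coordOpen (i j : Fin (n + 1)) (v : Fin (n + 1) → K) (hv : v i ≠ 0) :
    projPoint i v hv (fieldPoint K) ∈ coordOpen j ↔ v j ≠ 0 := by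
  have h1 : projPoint i v hv (fieldPoint K) ∈ coordOpen j ↔
      Spec.map (CommRingCat.ofHom (chartEval i v hv)) (fieldPoint K) ∈
        (coordChart i ⁻¹ᵁ coordOpen j) := by
    rw [projPoint, Scheme.Hom.comp_apply]
    rfl
  rw [h1]
  have h2 : coordChart i ⁻¹ᵁ coordOpen j = PrimeSpectrum.basicOpen (coordRatio i j) :=
    Proj.awayι_preimage_basicOpen (coordGrading n) (X_mem_coordGrading i) one_pos
      (X_mem_coordGrading j) one_pos
  rw [h2]
  have h3 : chartEval i v hv (coordRatio i j) ∉ IsLocalRing.maximalIdeal K ↔ v j ≠ 0 := by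
    rw [IsLocalRing.notMem_maximalIdeal, isUnit_iff_ne_zero, chartEval_coordRatio]
    simp [hv]
  exact h3

theorem projPoint_injective (i : Fin (n + 1)) {v w : Fin (n + 1) → K} (hv : v i = 1) (hw : w i = 1)
    (h : projPoint i v (hv ▸ one_ne_zero) = projPoint i w (hw ▸ one_ne_zero)) : v = w := by
  have h1 := Spec.map_injective ((cancel_mono (coordChart i)).1 h)
  funext j
  have h2 := RingHom.congr_fun (congrArg CommRingCat.Hom.hom h1) (coordRatio i j)
  simp only [CommRingCat.hom_ofHom] at h2
  rwa [chartEval_coordRatio, chartEval_coordRatio, hv, hw, div_one, div_one] at h2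

/-- `Spec K` has a single point, so `g` factors through the chart as soon as that point lies in it.
-/
theorem exists_eq_projPoint (i : Fin (n + 1)) (g : Spec (CommRingCat.of K) ⟶ Proj (coordGrading n))
    (hg : g (fieldPoint K) ∈ coordOpen i) :
    ∃ (v : Fin (n + 1) → K) (hv : v i = 1), g = projPoint i v (hv ▸ one_ne_zero) := by
  have hrange : Set.range g ⊆ Set.range (coordChart i) := by
    rintro _ ⟨x, rfl⟩
    obtain rfl : x = fieldPoint K := Subsingleton.elim _ _
    have : (coordChart i).opensRange = coordOpen i :=
      Proj.opensRange_awayι (coordGrading n) _ (X_mem_coordGrading i) one_pos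
    rw [← this] at hg
    exact hg
  let ψ := IsOpenImmersion.lift (coordChart i) g hrange
  obtain ⟨v, hv, h⟩ := eq_chartEval i (Spec.preimage ψ).hom
  refine ⟨v, hv, ?_⟩
  rw [projPoint, ← h, CommRingCat.ofHom_hom, Spec.map_preimage]
  exact (IsOpenImmersion.lift_fac _ _ hrange).symm

/-- Coordinates are normalized so that the first nonzero one is 1. Its index is intrinsic: the least
`i` for which the point lies in `x_i ≠ 0`. -/
theorem projPoint_bijective (n : ℕ) (K : Type) [Field K] :
    Function.Bijective fun x : Σ i : Fin (n + 1),
      {v : Fin (n + 1) → K // v i = 1 ∧ ∀ j < i, v j = 0} =>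
        projPoint x.1 x.2.1 (by rw [x.2.2.1]; exact one_ne_zero) := by
  constructor
  · have hle : ∀ (i i' : Fin (n + 1)) (v w : Fin (n + 1) → K) (hv : v i = 1)
        (hw : w i' = 1 ∧ ∀ j < i', w j = 0),
        projPoint i v (hv ▸ one_ne_zero) = projPoint i' w (hw.1 ▸ one_ne_zero) → i' ≤ i := by
      intro i i' v w hv hw h
      by_contra! hlt
      have h1 := (projPoint_mem_coordOpen i i v (hv ▸ one_ne_zero)).2 (hv ▸ one_ne_zero)
      rw [h, projPoint_mem_coordOpen] at h1
      exact h1 (hw.2 i hlt)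
    rintro ⟨i, v, hv⟩ ⟨i', w, hw⟩ h
    obtain rfl : i = i' := le_antisymm (hle i' i w v hw.1 hv h.symm) (hle i i' v w hv.1 hw h)
    obtain rfl := projPoint_injective i hv.1 hw.1 h
    rfl
  · intro g
    have hex : ∃ i : Fin (n + 1), g (fieldPoint K) ∈ coordOpen i := by
      have : g (fieldPoint K) ∈ ⨆ i, coordOpen (n := n) i := by
        rw [iSup_coordOpen]; trivial
      exact TopologicalSpace.Opens.mem_iSup.1 this
    obtain ⟨i, hi, hmin⟩ := WellFounded.has_min wellFounded_lt
      {i : Fin (n + 1) | g (fieldPoint K) ∈ coordOpen i} hex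
    obtain ⟨v, hv, rfl⟩ := exists_eq_projPoint i g hi
    refine ⟨⟨i, v, hv, fun j hj => ?_⟩, rfl⟩
    by_contra hne
    exact hmin j ((projPoint_mem_coordOpen i j v _).2 hne) hj

theorem natCard_normalized (n : ℕ) (K : Type) [Field K] [Finite K] (i : Fin (n + 1)) :
    Nat.card {v : Fin (n + 1) → K // v i = 1 ∧ ∀ j < i, v j = 0} = Nat.card K ^ (n - (i : ℕ)) := by
  let e : {v : Fin (n + 1) → K // v i = 1 ∧ ∀ j < i, v j = 0} ≃ ({j // i < j} → K) :=
    { toFun v j := v.1 j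
      invFun w := ⟨fun j => if h : i < j then w ⟨j, h⟩ else if j = i then 1 else 0, by simp,
        fun j hj => by simp [hj.not_gt, hj.ne]⟩
      left_inv v := by
        ext j
        rcases lt_trichotomy i j with h | rfl | h
        · simp [h]
        · simp [v.2.1]
        · simp [h.not_gt, h.ne, v.2.2 j h]
      right_inv w := by
        funext j
        simp [j.2] }
  rw [Nat.card_congr e, Nat.card_fun]
  rw [Nat.card_eq_fintype_card (α := {j // i < j}), Fintype.card_subtype, Finset.filter_lt_eq_Ioi, Fin.card_Ioi]
  rfl

theorem locallyOfFiniteType_projectiveSpaceZ (n : ℕ) :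
    LocallyOfFiniteType (specZIsTerminal.from (Proj (coordGrading n))) := by
  have hsurj : Function.Surjective (algebraMap ℤ (coordGrading n 0)) := by
    rintro ⟨f, hf⟩
    have hf' : f ∈ MvPolynomial.homogeneousSubmodule (Fin (n + 1)) ℤ 0 := hf
    rw [MvPolynomial.homogeneousSubmodule_zero, Submodule.mem_one] at hf'
    obtain ⟨r, rfl⟩ := hf'
    exact ⟨r, rfl⟩
  have : Algebra.FiniteType (coordGrading n 0) (MvPolynomial (Fin (n + 1)) ℤ) :=
    ⟨Subalgebra.fg_def.2 ⟨_, Set.finite_range _, adjoin_X_coordGrading⟩⟩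
  have h1 : LocallyOfFiniteType (Proj.toSpecZero (coordGrading n)) := inferInstance
  have h2 : LocallyOfFiniteType
      (Spec.map (CommRingCat.ofHom (algebraMap ℤ (coordGrading n 0)))) := by
    rw [HasRingHomProperty.Spec_iff (P := @LocallyOfFiniteType)]
    exact RingHom.FiniteType.of_surjective _ hsurj
  rw [specZIsTerminal.hom_ext (specZIsTerminal.from (Proj (coordGrading n)))
    (Proj.toSpecZero (coordGrading n) ≫
      Spec.map (CommRingCat.ofHom (algebraMap ℤ (coordGrading n 0))))]
  exact MorphismProperty.comp_mem _ _ _ h1 h2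

theorem isPolynomialCount_projectiveSpaceZ (n : ℕ) :
    IsPolynomialCount (projectiveSpaceZ n) (Finset.range (n + 1)) where
  locallyOfFiniteType := locallyOfFiniteType_projectiveSpaceZ n
  finite_hom K _ _ := Finite.of_equiv _ (Equiv.ofBijective _ (projPoint_bijective n K))
  natCard_hom K _ _ := by
    change Nat.card (_ ⟶ Proj (coordGrading n)) = _
    rw [← Nat.card_congr (Equiv.ofBijective _ (projPoint_bijective n K)), Nat.card_sigma]
    simp only [natCard_normalized]
    rw [Fin.sum_univ_eq_sum_range fun i => Nat.card K ^ (n - i)]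
    exact Finset.sum_range_reflect (fun j => Nat.card K ^ j) (n + 1)

end ProjectiveSpace

/-! ### Hermite normal form -/

section HermiteNormalForm

open Matrix

variable {N : ℕ}

/-- Lower triangular with positive diagonal. -/
def IsPosLowerTriangular (M : Matrix (Fin N) (Fin N) ℤ) : Prop :=
  (∀ i j, i < j → M i j = 0) ∧ ∀ j, 0 < M j j

theorem det_eq_prod_diag {M : Matrix (Fin N) (Fin N) ℤ} (h : ∀ i j, i < j → M i j = 0) :
    M.det = ∏ i, M i i :=
  det_of_isLowerTriangular M fun i j hij => h i j hij

theorem IsReducedMatrix.isPosLowerTriangular {M : Matrix (Fin N) (Fin N) ℤ}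
    (h : IsReducedMatrix M) (hdet : 0 < M.det) : IsPosLowerTriangular M := by
  refine ⟨h.1, fun j => lt_of_le_of_ne (h.2.1 j) fun h0 => hdet.ne' ?_⟩
  rw [det_eq_prod_diag h.1]
  exact Finset.prod_eq_zero (Finset.mem_univ j) h0.symm

theorem IsPosLowerTriangular.det_pos {M : Matrix (Fin N) (Fin N) ℤ}
    (h : IsPosLowerTriangular M) : 0 < M.det := by
  rw [det_eq_prod_diag h.1]
  exact Finset.prod_pos fun j _ => h.2 j

theorem IsPosLowerTriangular.vecMul_apply {M : Matrix (Fin N) (Fin N) ℤ}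
    (h : IsPosLowerTriangular M) {w : Fin N → ℤ} {k : Fin N} (hw : ∀ i, k < i → w i = 0) :
    (w ᵥ* M) k = w k * M k k := by
  rw [vecMul, dotProduct, Finset.sum_eq_single k]
  · intro i _ hik
    rcases hik.lt_or_gt with hlt | hgt
    · rw [h.1 i k hlt, mul_zero]
    · rw [hw i hgt, zero_mul]
  · simp

/-- Descending induction: once the later entries of `w` vanish, the `j`-th coordinate is `w j * M j
j`, and a multiple of `M j j` smaller than it is zero. -/
theorem IsPosLowerTriangular.eq_zero_of_vecMul {M : Matrix (Fin N) (Fin N) ℤ}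
    (h : IsPosLowerTriangular M) {w : Fin N → ℤ} {i : Fin N}
    (hsmall : ∀ j, i < j → |(w ᵥ* M) j| < M j j) {j : Fin N} (hj : i < j) : w j = 0 := by
  induction j using WellFoundedGT.induction with
  | ind j ih =>
    have h1 := hsmall j hj
    rw [h.vecMul_apply fun k hk => ih k hk (hj.trans hk), abs_mul, abs_of_pos (h.2 j)] at h1
    by_contra hne
    have := Int.one_le_abs hne
    nlinarith [h.2 j]

theorem IsPosLowerTriangular.eq_zero_of_vecMul_small {M : Matrix (Fin N) (Fin N) ℤ}
    (h : IsPosLowerTriangular M) {w : Fin N → ℤ} (hsmall : ∀ j, |(w ᵥ* M) j| < M j j) : w = 0 := by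
  funext j
  induction j using WellFoundedGT.induction with
  | ind j ih =>
    have h1 := hsmall j
    rw [h.vecMul_apply ih, abs_mul, abs_of_pos (h.2 j)] at h1
    by_contra hne
    have := Int.one_le_abs hne
    nlinarith [h.2 j]

/-- Uniqueness of the Hermite normal form. -/
theorem IsReducedMatrix.eq_of_eq_mul {M M' γ : Matrix (Fin N) (Fin N) ℤ} (hM : IsReducedMatrix M)
    (hM' : IsReducedMatrix M') (hdet : 0 < M.det) (hγ : γ.det = 1) (h : M' = γ * M) : M' = M := by
  have hL := hM.isPosLowerTriangular hdet
  have hL' := hM'.isPosLowerTriangular (by rw [h, det_mul, hγ, one_mul]; exact hdet)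
  have hrow : ∀ i, γ i ᵥ* M = M' i := fun i => by rw [h]; rfl
  -- Row `i` of `M'` vanishes beyond `i`, which forces the same for row `i` of `γ`.
  have htri : ∀ i j, i < j → γ i j = 0 := fun i j hij => by
    refine hL.eq_zero_of_vecMul (i := i) (fun j hj => ?_) hij
    rw [hrow, hM'.1 i j hj, abs_zero]
    exact hL.2 j
  have hdiag : ∀ i, γ i i * M i i = M' i i := fun i => by
    rw [← hrow, hL.vecMul_apply (htri i)]
  have hone : ∀ i, γ i i = 1 := fun i => by
    have h1 : γ i i ∣ 1 := by
      rw [← hγ, det_eq_prod_diag htri]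
      exact Finset.dvd_prod_of_mem _ (Finset.mem_univ i)
    have h2 : 0 < γ i i := by
      refine pos_of_mul_pos_left ?_ (hL.2 i).le
      rw [hdiag]
      exact hL'.2 i
    exact Int.eq_one_of_dvd_one h2.le h1
  have hdiag' : ∀ i, M' i i = M i i := fun i => by rw [← hdiag, hone, one_mul]
  funext i
  -- Its image under `M` is `M' i - M i`, whose entries below the diagonal are differences of
  -- residues modulo the same diagonal entry, hence small.
  have hz : γ i - Pi.single i 1 = 0 := by
    refine hL.eq_zero_of_vecMul_small fun j => ?_
    rw [sub_vecMul, hrow, single_one_vecMul]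
    rcases lt_trichotomy i j with hij | rfl | hij
    · simpa [hM'.1 i j hij, hM.1 i j hij] using hL.2 j
    · simpa [hdiag'] using hL.2 i
    · have h1 := hM.2.2 i j hij
      have h2 := hM'.2.2 i j hij
      rw [hdiag'] at h2
      simp only [Pi.sub_apply, row]
      rw [abs_lt]
      omega
  rw [← hrow, sub_eq_zero.1 hz, single_one_vecMul]
  rfl

/-- Reduction of a vector modulo the rows of a lower triangular matrix. -/
theorem IsPosLowerTriangular.exists_reduce {B : Matrix (Fin N) (Fin N) ℤ}
    (hB : IsPosLowerTriangular B) (k : ℕ) (v : Fin N → ℤ) :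
    ∃ w : Fin N → ℤ, (∀ j : Fin N, k ≤ j → (v - w ᵥ* B) j = v j) ∧
      ∀ j : Fin N, (j : ℕ) < k → 0 ≤ (v - w ᵥ* B) j ∧ (v - w ᵥ* B) j < B j j := by
  induction k generalizing v with
  | zero => exact ⟨0, by simp, by simp⟩
  | succ k ih =>
    by_cases hk : k < N
    · let i : Fin N := ⟨k, hk⟩
      -- Coordinates are reduced from the right: row `i` does not touch those after `i`, and the
      -- induction hypothesis handles those before.
      let v₁ := v - (v i / B i i) • B i
      obtain ⟨w, h1, h2⟩ := ih v₁
      have hw : v - (w + Pi.single i (v i / B i i)) ᵥ* B = v₁ - w ᵥ* B := by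
        rw [add_vecMul, single_vecMul]
        simp only [v₁, row]
        abel
      refine ⟨w + Pi.single i (v i / B i i), fun j hj => ?_, fun j hj => ?_⟩
      · rw [hw, h1 j (by omega)]
        have : B i j = 0 := hB.1 i j (Fin.lt_def.2 hj)
        simp [v₁, this]
      · rw [hw]
        rcases Nat.lt_succ_iff_lt_or_eq.1 hj with hlt | heq
        · exact h2 j hlt
        · obtain rfl : j = i := Fin.ext heq
          rw [h1 _ heq.ge]
          have : v₁ i = v i % B i i := by
            simp only [v₁, Pi.sub_apply, Pi.smul_apply, smul_eq_mul, Int.emod_def]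
            ring
          rw [this]
          exact ⟨Int.emod_nonneg _ (hB.2 i).ne', Int.emod_lt_of_pos _ (hB.2 i)⟩
    · obtain ⟨w, h1, h2⟩ := ih v
      exact ⟨w, fun j hj => h1 j (by omega), fun j hj => h2 j (by omega)⟩

/-- The vectors of a lattice with vanishing coordinates after the `i`-th. -/
def truncateLattice (L : Submodule ℤ (Fin N → ℤ)) (i : Fin N) : Submodule ℤ (Fin N → ℤ) where
  carrier := {v | v ∈ L ∧ ∀ j, i < j → v j = 0}
  add_mem' hv hw := ⟨add_mem hv.1 hw.1, fun j hj => by simp [hv.2 j hj, hw.2 j hj]⟩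
  zero_mem' := ⟨zero_mem _, fun _ _ => rfl⟩
  smul_mem' c v hv := ⟨L.smul_mem c hv.1, fun j hj => by simp [hv.2 j hj]⟩

/-- The `i`-th coordinates form an ideal of `ℤ`; `b` lifts a generator, up to sign. -/
theorem exists_generator_truncateLattice (L : Submodule ℤ (Fin N → ℤ)) (i : Fin N)
    (h : ∃ v ∈ truncateLattice L i, v i ≠ 0) :
    ∃ b ∈ truncateLattice L i, 0 < b i ∧ ∀ v ∈ truncateLattice L i, b i ∣ v i := by
  let J : Ideal ℤ := (truncateLattice L i).map (LinearMap.proj i)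
  have hJ : ∀ v ∈ truncateLattice L i, v i ∈ J := fun v hv => ⟨v, hv, rfl⟩
  obtain ⟨b, hb, hbg⟩ : Submodule.IsPrincipal.generator J ∈ J :=
    Submodule.IsPrincipal.generator_mem J
  have hdvd : ∀ v ∈ truncateLattice L i, b i ∣ v i := fun v hv => by
    have := (Submodule.IsPrincipal.mem_iff_generator_dvd J).1 (hJ v hv)
    rwa [← show b i = Submodule.IsPrincipal.generator J from hbg] at this
  have hne : b i ≠ 0 := by
    obtain ⟨v, hv, hv0⟩ := h
    intro h0
    exact hv0 (zero_dvd_iff.1 (h0 ▸ hdvd v hv))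
  rcases hne.lt_or_gt with hlt | hgt
  · exact ⟨-b, neg_mem hb, by simpa using hlt, fun v hv => by simpa using hdvd v hv⟩
  · exact ⟨b, hb, hgt, hdvd⟩

/-- Existence of the Hermite normal form. -/
theorem exists_isReducedMatrix_mul (M : Matrix (Fin N) (Fin N) ℤ) (hM : 0 < M.det) :
    ∃ γ : SpecialLinearGroup (Fin N) ℤ, IsReducedMatrix (γ.1 * M) := by
  let L : Submodule ℤ (Fin N → ℤ) := LinearMap.range M.vecMulLinear
  -- Since `adj(M) * M = det M`, the row lattice contains `det M` times each basis vector.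
  have hex : ∀ i, ∃ v ∈ truncateLattice L i, v i ≠ 0 := fun i => by
    refine ⟨Pi.single i M.det, ⟨⟨Pi.single i 1 ᵥ* M.adjugate, ?_⟩, fun j hj => ?_⟩, ?_⟩
    · rw [vecMulLinear_apply, vecMul_vecMul, adjugate_mul, vecMul_smul, vecMul_one]
      ext j
      by_cases h : j = i <;> simp [h]
    · rw [Pi.single_eq_of_ne hj.ne']
    · simpa using hM.ne'
  choose b hb hpos hdvd using fun i => exists_generator_truncateLattice L i (hex i)
  have hb' : IsPosLowerTriangular (of b) := ⟨fun i j hij => (hb i).2 j hij, hpos⟩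
  choose w hw1 hw2 using fun i : Fin N => hb'.exists_reduce i (b i)
  have hmemL : ∀ u, u ᵥ* of b ∈ L := fun u => by
    rw [vecMul_eq_sum]
    exact sum_mem fun i _ => L.smul_mem _ (hb i).1
  let B : Matrix (Fin N) (Fin N) ℤ := of fun i => b i - w i ᵥ* of b
  have hBL : ∀ i, B i ∈ L := fun i => sub_mem (hb i).1 (hmemL _)
  have hBdiag : ∀ i, B i i = b i i := fun i => hw1 i i le_rfl
  have hBtri : ∀ i j, i < j → B i j = 0 := fun i j hij =>
    (hw1 i j (Fin.le_def.1 hij.le)).trans ((hb i).2 j hij)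
  have hBlow : IsPosLowerTriangular B := ⟨hBtri, fun j => (hBdiag j).symm ▸ hpos j⟩
  have hBred : IsReducedMatrix B := by
    refine ⟨hBtri, fun j => (hBlow.2 j).le, fun i j hij => ?_⟩
    rw [hBdiag]
    exact hw2 i j hij
  choose U hU using hBL
  have hUM : of U * M = B := by
    funext i
    exact hU i
  -- After full reduction modulo `B`, the remainder stays in the lattice. From the right, each
  -- coordinate is divisible by `B j j` and lies in `[0, B j j)`, so it vanishes.
  have hspan : ∀ v ∈ L, ∃ u, u ᵥ* B = v := fun v hv => by
    obtain ⟨u, -, hu⟩ := hBlow.exists_reduce N v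
    refine ⟨u, (sub_eq_zero.1 ?_).symm⟩
    have hvL : v - u ᵥ* B ∈ L := by
      refine sub_mem hv ?_
      rw [vecMul_eq_sum]
      exact sum_mem fun i _ => L.smul_mem _ ⟨U i, hU i⟩
    funext j
    induction j using WellFoundedGT.induction with
    | ind j ih =>
      have h1 := hdvd j _ ⟨hvL, ih⟩
      rw [← hBdiag] at h1
      exact Int.eq_zero_of_dvd_of_nonneg_of_lt (hu j j.2).1 (hu j j.2).2 h1
  have hML : ∀ i, M i ∈ L := fun i => ⟨Pi.single i 1, by simp [row]⟩
  choose V hV using fun i => hspan (M i) (hML i)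
  have hVB : of V * B = M := by
    funext i
    exact hV i
  have hUV : (of V).det * (of U).det = 1 := by
    have : M.det * ((of V).det * (of U).det) = M.det * 1 := by
      conv_rhs => rw [mul_one, ← hVB, ← hUM, det_mul, det_mul]
      ring
    exact mul_left_cancel₀ hM.ne' this
  -- The two transition determinants are inverse integers; positivity selects `1` over `-1`.
  have hUpos : 0 < (of U).det := by
    refine pos_of_mul_pos_left ?_ hM.le
    rw [← det_mul, hUM]
    exact hBlow.det_pos
  have hUdet : (of U).det = 1 := Int.eq_one_of_dvd_one hUpos.le ⟨_, (mul_comm _ _).trans hUV |>.symm⟩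
  exact ⟨⟨of U, hUdet⟩, hUM.symm ▸ hBred⟩

end HermiteNormalForm

/-! ### Dirichlet series of physical systems with logarithmic energy levels -/

section LogLevels

/-- A sum over a type graded by the positive integers, as a Dirichlet series. -/
theorem hasSum_rpow_level_iff {T : Type} (lev : T → ℕ+) {D : ℕ+ → ℕ}
    (hD : ∀ k, Finite {x // lev x = k} ∧ Nat.card {x // lev x = k} = D k) {b S : ℝ} :
    HasSum (fun x => ((lev x : ℕ) : ℝ) ^ (-b)) S ↔ HasSum (fun k => (D k : ℝ) * (k : ℝ) ^ (-b)) S := by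
  have hfib : ∀ k : ℕ+, HasSum (fun x : {x // lev x = k} => ((lev x.1 : ℕ) : ℝ) ^ (-b))
      ((D k : ℝ) * (k : ℝ) ^ (-b)) := by
    intro k
    have := (hD k).1
    have := Fintype.ofFinite {x // lev x = k}
    rw [← (hD k).2, Nat.card_eq_fintype_card]
    have h : (∑ x : {x // lev x = k}, ((lev x.1 : ℕ) : ℝ) ^ (-b)) =
        (Fintype.card {x // lev x = k} : ℝ) * (k : ℝ) ^ (-b) := by
      rw [Finset.sum_congr rfl fun (x : {x // lev x = k}) _ => by rw [x.2]]
      simp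
    exact h ▸ hasSum_fintype _
  have h0 : ∀ x, 0 ≤ ((lev x : ℕ) : ℝ) ^ (-b) := fun x => by positivity
  rw [← (Equiv.sigmaFiberEquiv lev).hasSum_iff]
  refine ⟨fun h => h.sigma hfib, fun h => HasSum.sigma_of_hasSum h hfib ?_⟩
  refine (summable_sigma_of_nonneg fun x => h0 _).2 ⟨fun k => (hfib k).summable, ?_⟩
  exact h.summable.congr fun k => (hfib k).tsum_eq.symm

/-- An infinite fibre would be a convergent series with a positive constant term. This yields
finiteness of `Red_N(k)` from its Dirichlet series. -/
theorem finite_level_of_summable {T : Type} (lev : T → ℕ+) {b : ℝ}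
    (h : Summable fun x => ((lev x : ℕ) : ℝ) ^ (-b)) (k : ℕ+) : Finite {x // lev x = k} := by
  by_contra hinf
  rw [not_finite_iff_infinite] at hinf
  have h1 := h.subtype {x | lev x = k}
  have h2 : Summable fun _ : {x // lev x = k} => ((k : ℕ) : ℝ) ^ (-b) :=
    h1.congr fun x => by
      have hx : lev x.1 = k := x.2
      simp only [Function.comp, hx]
  rw [summable_const_iff] at h2
  have : (0 : ℝ) < ((k : ℕ) : ℝ) ^ (-b) := by have := k.pos; positivity
  exact this.ne' h2

theorem log_pnat_injective : Function.Injective fun k : ℕ+ => Real.log (k : ℝ) := by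
  intro k l h
  have := Real.log_injOn_pos (Set.mem_Ioi.2 (by exact_mod_cast k.pos))
    (Set.mem_Ioi.2 (by exact_mod_cast l.pos)) h
  exact_mod_cast this

namespace PhysicalSystem

variable {Q : PhysicalSystem} {D : ℕ+ → ℕ}

/-- A level function with fibres of cardinality `D` describes the energy levels. -/
theorem hasLogLevels_of_level (lev : Q.State → ℕ+) (hlev : ∀ x, Q.energy x = Real.log (lev x : ℝ))
    (hsurj : Function.Surjective lev)
    (hD : ∀ k, Finite {x // lev x = k} ∧ Nat.card {x // lev x = k} = D k) : Q.HasLogLevels D := by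
  have henergy : Q.energy = (fun k : ℕ+ => Real.log (k : ℝ)) ∘ lev := funext hlev
  have hiff : ∀ (k : ℕ+) x, Q.energy x = Real.log (k : ℝ) ↔ lev x = k := fun k x => by
    rw [hlev]
    exact log_pnat_injective.eq_iff
  refine ⟨by rw [henergy, hsurj.range_comp], fun k => ?_⟩
  simp only [hiff]
  exact hD k

theorem HasLogLevels.exists_level (h : Q.HasLogLevels D) :
    ∃ lev : Q.State → ℕ+, (∀ x, Q.energy x = Real.log (lev x : ℝ)) ∧
      ∀ k, Finite {x // lev x = k} ∧ Nat.card {x // lev x = k} = D k := by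
  have hx : ∀ x, ∃ k : ℕ+, Real.log (k : ℝ) = Q.energy x := fun x => by
    have : Q.energy x ∈ Set.range (fun k : ℕ+ => Real.log (k : ℝ)) := h.1 ▸ Set.mem_range_self x
    exact this
  choose lev hlev using hx
  refine ⟨lev, fun x => (hlev x).symm, fun k => ?_⟩
  have hiff : ∀ x, lev x = k ↔ Q.energy x = Real.log (k : ℝ) := fun x => by
    rw [← hlev]
    exact log_pnat_injective.eq_iff.symm
  simp only [hiff]
  exact h.2 k

theorem HasLogLevels.hasSum_exp (h : Q.HasLogLevels D) {b S : ℝ}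
    (hS : HasSum (fun k : ℕ+ => (D k : ℝ) * (k : ℝ) ^ (-b)) S) :
    HasSum (fun x => Real.exp (-b * Q.energy x)) S := by
  obtain ⟨lev, hlev, hD⟩ := h.exists_level
  refine ((hasSum_rpow_level_iff lev hD).2 hS).congr_fun fun x => ?_
  have : (0 : ℝ) < ((lev x : ℕ) : ℝ) := by exact_mod_cast (lev x).pos
  rw [hlev, Real.rpow_def_of_pos this]
  ring_nf

theorem bostConnes_hasLogLevels : bostConnes.HasLogLevels fun _ => 1 := by
  refine hasLogLevels_of_level (Q := bostConnes) (fun k : ℕ+ => k) (fun _ => rfl)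
    (fun k => ⟨k, rfl⟩) fun k => ?_
  let := Unique.subtypeEq k
  change Finite {x : ℕ+ // x = k} ∧ Nat.card {x : ℕ+ // x = k} = 1
  exact ⟨inferInstance, Nat.card_unique⟩

theorem exists_hasLogLevels_pow (n : ℕ) :
    ∃ Q : PhysicalSystem, Q.HasLogLevels fun k => (k : ℕ) ^ n := by
  let Q : PhysicalSystem :=
    { State := Σ k : ℕ+, Fin ((k : ℕ) ^ n)
      energy := fun x => Real.log (x.1 : ℝ) }
  refine ⟨Q, hasLogLevels_of_level (Q := Q) Sigma.fst (fun _ => rfl)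
    (fun k => ⟨⟨k, ⟨0, pow_pos k.pos n⟩⟩, rfl⟩) fun k => ?_⟩
  let e : {x : Σ k : ℕ+, Fin ((k : ℕ) ^ n) // x.1 = k} ≃ Fin ((k : ℕ) ^ n) :=
    Equiv.sigmaSubtype k
  exact ⟨Finite.of_equiv _ e.symm, (Nat.card_congr e).trans (by simp)⟩

/-- The positive integer with given exponents of the primes. -/
def juliaLevel (x : Nat.Primes →₀ ℕ) : ℕ+ :=
  ⟨x.prod fun p k => (p : ℕ) ^ k, Finset.prod_pos fun p _ => pow_pos p.2.pos _⟩

/-- Unique factorization into primes. -/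
theorem juliaLevel_bijective : Function.Bijective juliaLevel := by
  have hfac : ∀ (x : Nat.Primes →₀ ℕ) (q : Nat.Primes),
      ((juliaLevel x : ℕ)).factorization q = x q := by
    intro x q
    change (x.prod fun p k => (p : ℕ) ^ k).factorization q = x q
    rw [Finsupp.prod, Nat.factorization_prod fun p _ => (pow_pos p.2.pos _).ne', Finset.sum_apply']
    simp_rw [Nat.factorization_pow, Finsupp.smul_apply]
    rw [Finset.sum_eq_single q]
    · simp [Nat.Prime.factorization_self q.2]
    · intro p _ hpq
      rw [p.2.factorization, Finsupp.single_eq_of_ne]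
      · simp
      · exact fun h => hpq (Subtype.ext h.symm)
    · intro hq
      simp [Finsupp.notMem_support_iff.1 hq]
  constructor
  · intro x y h
    ext q
    rw [← hfac, h, hfac]
  · intro k
    let x : Nat.Primes →₀ ℕ := (k : ℕ).factorization.comapDomain Subtype.val
      (Subtype.val_injective.injOn)
    refine ⟨x, PNat.coe_injective (Nat.eq_of_factorization_eq (PNat.ne_zero _) k.ne_zero fun q => ?_)⟩
    by_cases hq : q.Prime
    · exact (hfac x ⟨q, hq⟩).trans rfl
    · rw [Nat.factorization_eq_zero_of_not_prime _ hq, Nat.factorization_eq_zero_of_not_prime _ hq]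

theorem log_juliaLevel (x : Nat.Primes →₀ ℕ) :
    Real.log (juliaLevel x : ℝ) = x.sum fun p k => (k : ℝ) * Real.log (p : ℝ) := by
  have h : ((juliaLevel x : ℕ) : ℝ) = ∏ p ∈ x.support, (p : ℝ) ^ x p := by
    simp [juliaLevel, Finsupp.prod]
  rw [h, Real.log_prod fun p _ => (pow_pos (prime_pos p) _).ne']
  exact Finset.sum_congr rfl fun p _ => Real.log_pow _ _

theorem julia_hasLogLevels : julia.HasLogLevels fun _ => 1 := by
  refine hasLogLevels_of_level (Q := julia) juliaLevel (fun x => ?_) juliaLevel_bijective.2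
    fun k => ?_
  · exact (log_juliaLevel x).symm
  · let e := (Equiv.ofBijective _ juliaLevel_bijective).subtypeEquiv
      (p := fun x => juliaLevel x = k) (q := fun l => l = k) fun x => Iff.rfl
    have : Unique {x : ℕ+ // x = k} := Unique.subtypeEq k
    exact ⟨Finite.of_equiv _ e.symm, (Nat.card_congr e).trans Nat.card_unique⟩

end PhysicalSystem

end LogLevels

/-! ### Counting reduced matrices -/

section ReducedMatrices

open Matrix

/-- The reduced matrices of positive determinant. -/
abbrev PosReducedMatrix (N : ℕ) : Type :=
  {M : Matrix (Fin N) (Fin N) ℤ // IsReducedMatrix M ∧ 0 < M.det}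

namespace PosReducedMatrix

variable {N : ℕ}

/-- The determinant as a positive integer. -/
def level (M : PosReducedMatrix N) : ℕ+ := ⟨M.1.det.toNat, by have := M.2.2; omega⟩

theorem coe_level (M : PosReducedMatrix N) : ((M.level : ℕ) : ℤ) = M.1.det :=
  Int.toNat_of_nonneg M.2.2.le

/-- The fibre of the determinant over `k` is `Red_N(k)`. -/
def levelEquiv (k : ℕ+) : {M : PosReducedMatrix N // M.level = k} ≃ redSet N k where
  toFun M := ⟨M.1.1, M.1.2.1, by rw [← coe_level, M.2]⟩
  invFun M := ⟨⟨M.1, M.2.1, by rw [M.2.2]; exact_mod_cast k.pos⟩, by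
    apply PNat.coe_injective
    exact_mod_cast (coe_level ⟨M.1, M.2.1, by rw [M.2.2]; exact_mod_cast k.pos⟩).trans M.2.2⟩
  left_inv _ := rfl
  right_inv _ := rfl

/-- The columns of a reduced matrix of positive determinant: a positive diagonal entry `d` and
residues modulo `d` below it. -/
abbrev Columns (N : ℕ) : Type := ∀ j : Fin N, Σ d : ℕ+, ({i : Fin N // j < i} → Fin d)

/-- The reduced matrix with given columns. -/
def ofColumns (x : Columns N) : PosReducedMatrix N :=
  let M : Matrix (Fin N) (Fin N) ℤ := of fun i j =>
    if h : j < i then (((x j).2 ⟨i, h⟩ : ℕ) : ℤ) else if i = j then (((x j).1 : ℕ) : ℤ) else 0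
  have htri : ∀ i j, i < j → M i j = 0 := fun i j hij => by simp [M, hij.not_gt, hij.ne]
  have hdiag : ∀ j, M j j = ((x j).1 : ℕ) := fun j => by simp [M]
  have hpos : ∀ j, 0 < M j j := fun j => by
    rw [hdiag]
    exact_mod_cast (x j).1.pos
  ⟨M, ⟨htri, fun j => (hpos j).le, fun i j hij => by
    rw [hdiag]
    simp [M, hij]⟩, IsPosLowerTriangular.det_pos ⟨htri, hpos⟩⟩

theorem ofColumns_diag (x : Columns N) (j : Fin N) : (ofColumns x).1 j j = ((x j).1 : ℕ) := by
  simp [ofColumns]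

theorem ofColumns_below (x : Columns N) {i j : Fin N} (h : j < i) :
    (ofColumns x).1 i j = ((x j).2 ⟨i, h⟩ : ℕ) := by
  simp [ofColumns, h]

theorem ofColumns_bijective : Function.Bijective (ofColumns (N := N)) := by
  constructor
  · intro x y hxy
    funext j
    have hd : (((x j).1 : ℕ) : ℤ) = ((y j).1 : ℕ) := by
      rw [← ofColumns_diag, ← ofColumns_diag, hxy]
    have hf : ∀ i (h : j < i), (((x j).2 ⟨i, h⟩ : ℕ) : ℤ) = ((y j).2 ⟨i, h⟩ : ℕ) := fun i h => by
      rw [← ofColumns_below, ← ofColumns_below, hxy]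
    -- The residues have type `Fin d`, so the diagonal entries must be identified before the
    -- residues can be compared.
    generalize x j = a at *
    generalize y j = b at *
    obtain ⟨d, f⟩ := a
    obtain ⟨e, g⟩ := b
    obtain rfl : d = e := PNat.coe_injective (by exact_mod_cast hd)
    congr
    funext i
    exact Fin.ext (by exact_mod_cast hf i.1 i.2)
  · intro M
    have hpos := (M.2.1.isPosLowerTriangular M.2.2).2
    refine ⟨fun j => ⟨⟨(M.1 j j).toNat, by have := hpos j; omega⟩, fun i => ⟨(M.1 i j).toNat, by
      have := M.2.1.2.2 i j i.2
      change _ < (M.1 j j).toNat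
      omega⟩⟩, Subtype.ext ?_⟩
    funext i j
    rcases lt_trichotomy j i with h | rfl | h
    · rw [ofColumns_below _ h]
      exact Int.toNat_of_nonneg (M.2.1.2.2 i j h).1
    · rw [ofColumns_diag]
      exact Int.toNat_of_nonneg (hpos j).le
    · rw [M.2.1.1 i j h, (ofColumns _).2.1.1 i j h]

theorem level_ofColumns (x : Columns N) :
    ((ofColumns x).level : ℕ) = ∏ j, ((x j).1 : ℕ) := by
  have h := coe_level (ofColumns x)
  rw [det_eq_prod_diag (ofColumns x).2.1.1] at h
  simp only [ofColumns_diag] at h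
  exact_mod_cast h

theorem hasSum_pi_prod {N : ℕ} {α : Fin N → Type} {f : ∀ j, α j → ℝ} {S : Fin N → ℝ}
    (h0 : ∀ j a, 0 ≤ f j a) (h : ∀ j, HasSum (f j) (S j)) :
    HasSum (fun x : ∀ j, α j => ∏ j, f j (x j)) (∏ j, S j) := by
  induction N with
  | zero => simp
  | succ N ih =>
    rw [← (Fin.consEquiv α).hasSum_iff, Fin.prod_univ_succ]
    let g : (∀ j : Fin N, α j.succ) → ℝ := fun x => ∏ j : Fin N, f j.succ (x j)
    have h1 : HasSum g (∏ j : Fin N, S j.succ) :=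
      ih (fun j a => h0 j.succ a) (fun j => h j.succ)
    have hg : 0 ≤ g := fun x => Finset.prod_nonneg fun j _ => h0 j.succ (x j)
    have hf : 0 ≤ f 0 := fun a => h0 0 a
    have hs : Summable fun x : α 0 × (∀ j : Fin N, α j.succ) => f 0 x.1 * g x.2 :=
      Summable.mul_of_nonneg (h 0).summable h1.summable hf hg
    have h2 := HasSum.mul (h 0) h1 hs
    convert! h2 using 1
    funext x
    exact Fin.prod_univ_succ _

/-- The Dirichlet series that counts reduced matrices. -/
theorem hasSum_level {s : ℝ} (hs : (N : ℝ) < s) :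
    HasSum (fun M : PosReducedMatrix N => ((M.level : ℕ) : ℝ) ^ (-s))
      (∏ m ∈ Finset.range N, Real.exp (logZeta (s - m))) := by
  -- Below diagonal entry `d` of column `j` there are `d^(N-1-j)` choices of residues, so the column
  -- contributes `ζ(s - (N-1-j))`.
  have hcol : ∀ j : Fin N, HasSum
      (fun c : Σ d : ℕ+, ({i : Fin N // j < i} → Fin d) => ((c.1 : ℕ) : ℝ) ^ (-s))
      (Real.exp (logZeta (s - (N - 1 - (j : ℕ) : ℕ)))) := by
    intro j
    have hj : (((N - 1 - (j : ℕ) : ℕ) : ℝ)) + 1 ≤ N := by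
      have := j.2
      exact_mod_cast (by omega : N - 1 - (j : ℕ) + 1 ≤ N)
    have hcard : Nat.card {i : Fin N // j < i} = N - 1 - (j : ℕ) := by
      rw [Nat.card_eq_fintype_card, Fintype.card_subtype, Finset.filter_lt_eq_Ioi, Fin.card_Ioi]
    refine (hasSum_rpow_level_iff (D := fun d => (d : ℕ) ^ (N - 1 - (j : ℕ))) Sigma.fst
      fun d => ?_).2 ((hasSum_exp_logZeta (x := s - (N - 1 - (j : ℕ) : ℕ)) (by linarith)).congr_fun
      fun d => ?_)
    · let e := Equiv.sigmaSubtype (β := fun d : ℕ+ => {i : Fin N // j < i} → Fin d) d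
      refine ⟨Finite.of_equiv _ e.symm, (Nat.card_congr e).trans ?_⟩
      rw [Nat.card_fun, hcard, Nat.card_fin]
    · have hd : (0 : ℝ) < (d : ℕ) := by exact_mod_cast d.pos
      rw [Nat.cast_pow, ← Real.rpow_natCast, ← Real.rpow_add hd]
      congr 1
      ring
  rw [← (Equiv.ofBijective _ (ofColumns_bijective (N := N))).hasSum_iff]
  have h := hasSum_pi_prod (fun j c => by positivity) hcol
  rw [Fin.prod_univ_eq_prod_range fun j => Real.exp (logZeta (s - (N - 1 - j : ℕ))),
    Finset.prod_range_reflect (fun j => Real.exp (logZeta (s - (j : ℕ))))] at h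
  refine h.congr_fun fun x => ?_
  simp only [Function.comp, Equiv.ofBijective_apply, level_ofColumns]
  rw [Nat.cast_prod, Real.finsetProd_rpow _ _ fun j _ => by positivity]

theorem finite_and_natCard_level (k : ℕ+) :
    Finite {M : PosReducedMatrix N // M.level = k} ∧
      Nat.card {M : PosReducedMatrix N // M.level = k} = (redSet N k).ncard :=
  ⟨finite_level_of_summable _ (hasSum_level (lt_add_one (N : ℝ))).summable k,
    Nat.card_congr (levelEquiv k)⟩

theorem hasSum_ncard_redSet {s : ℝ} (hs : (N : ℝ) < s) :
    HasSum (fun k : ℕ+ => ((redSet N k).ncard : ℝ) * (k : ℝ) ^ (-s))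
      (∏ m ∈ Finset.range N, Real.exp (logZeta (s - m))) :=
  (hasSum_rpow_level_iff level finite_and_natCard_level).1 (hasSum_level hs)

/-- The class of a reduced matrix modulo `SL_N(ℤ)`. -/
def toState (M : PosReducedMatrix N) : Quotient (posDetSetoid N) :=
  Quotient.mk (posDetSetoid N) ⟨M.1, M.2.2⟩

/-- Injectivity is uniqueness of the Hermite normal form, surjectivity is its existence. -/
theorem toState_bijective : Function.Bijective (toState (N := N)) := by
  constructor
  · intro M M' h
    obtain ⟨γ, hγ⟩ := Quotient.exact h
    exact Subtype.ext (M.2.1.eq_of_eq_mul M'.2.1 M.2.2 γ.2 hγ).symm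
  · intro x
    induction x using Quotient.inductionOn with
    | h M =>
      obtain ⟨γ, hγ⟩ := exists_isReducedMatrix_mul M.1 M.2
      have hdet : 0 < (γ.1 * M.1).det := by rw [det_mul, γ.2, one_mul]; exact M.2
      have hrel : posDetSetoid N M ⟨γ.1 * M.1, hdet⟩ := ⟨γ, rfl⟩
      exact ⟨⟨γ.1 * M.1, hγ, hdet⟩, (Quotient.sound hrel).symm⟩

theorem level_surjective (n : ℕ) : Function.Surjective (level (N := n + 1)) := by
  intro k
  -- The matrix `diag(k, 1, …, 1)`; size at least 1 is needed, as the empty determinant is always 1.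
  let d : Fin (n + 1) → ℤ := Fin.cons (k : ℤ) 1
  have hd : ∀ j, 0 < d j := by
    intro j
    refine Fin.cases ?_ (fun j => ?_) j
    · simp only [d, Fin.cons_zero]
      exact_mod_cast k.pos
    · simp [d]
  have hdet : (diagonal d).det = k := by
    rw [det_diagonal, Fin.prod_univ_succ]
    simp [d]
  have hred : IsReducedMatrix (diagonal d) := by
    refine ⟨fun i j hij => diagonal_apply_ne _ hij.ne, fun j => ?_, fun i j hij => ?_⟩
    · rw [diagonal_apply_eq]
      exact (hd j).le
    · rw [diagonal_apply_ne _ hij.ne', diagonal_apply_eq]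
      exact ⟨le_rfl, hd j⟩
  let M : PosReducedMatrix (n + 1) := ⟨diagonal d, hred, by rw [hdet]; exact_mod_cast k.pos⟩
  have h : ((M.level : ℕ) : ℤ) = k := (coe_level M).trans hdet
  exact ⟨M, PNat.coe_injective (by exact_mod_cast h)⟩

end PosReducedMatrix

theorem PhysicalSystem.bostConnesGL_hasLogLevels (n : ℕ) :
    (bostConnesGL (n + 1)).HasLogLevels fun k => (redSet (n + 1) k).ncard := by
  let e := Equiv.ofBijective _ (PosReducedMatrix.toState_bijective (N := n + 1))
  let lev : (bostConnesGL (n + 1)).State → ℕ+ := fun x => (e.symm x).level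
  refine hasLogLevels_of_level lev (fun x => ?_)
    ((PosReducedMatrix.level_surjective n).comp e.symm.surjective) fun k => ?_
  · obtain ⟨M, rfl⟩ := e.surjective x
    simp only [lev, Equiv.symm_apply_apply]
    change Real.log ((M.1.det : ℤ) : ℝ) = _
    rw [← PosReducedMatrix.coe_level]
    rfl
  · let e' := e.symm.subtypeEquiv (p := fun x => lev x = k) (q := fun M => M.level = k)
      fun x => Iff.rfl
    obtain ⟨h1, h2⟩ := PosReducedMatrix.finite_and_natCard_level (N := n + 1) k
    exact ⟨Finite.of_equiv _ e'.symm, (Nat.card_congr e').trans h2⟩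

end ReducedMatrices

/-! ### Entropy and `L`-function of a scheme with polynomial point counts -/

theorem IsOneSubMulDeriv.congr {𝕜 : Type} [NontriviallyNormedField 𝕜] {F G : 𝕜 → 𝕜} {s S : 𝕜}
    (h : IsOneSubMulDeriv F s S) (hFG : G =ᶠ[nhds s] F) : IsOneSubMulDeriv G s S := by
  obtain ⟨F', hF, hS⟩ := h
  exact ⟨F', hF.congr_of_eventuallyEq hFG, by rw [hFG.eq_of_nhds, hS]⟩

theorem IsOneSubMulDeriv.unique {𝕜 : Type} [NontriviallyNormedField 𝕜] {F : 𝕜 → 𝕜} {s S T : 𝕜}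
    (hS : IsOneSubMulDeriv F s S) (hT : IsOneSubMulDeriv F s T) : S = T := by
  obtain ⟨F', hF, rfl⟩ := hS
  obtain ⟨G', hG, rfl⟩ := hT
  rw [hF.unique hG]

/-- The shift has derivative 1, while the multiplier remains `s` rather than `s - j`. -/
theorem isOneSubMulDeriv_sum_shift {𝕜 : Type} [NontriviallyNormedField 𝕜] {J : Finset ℕ}
    {F : 𝕜 → 𝕜} {F' : ℕ → 𝕜} {s : 𝕜} (h : ∀ j ∈ J, HasDerivAt F (F' j) (s - j)) :
    IsOneSubMulDeriv (fun x => ∑ j ∈ J, F (x - j)) s (∑ j ∈ J, (F (s - j) - s * F' j)) :=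
  ⟨∑ j ∈ J, F' j, HasDerivAt.fun_sum fun j hj => (h j hj).comp_sub_const s j, by
    rw [Finset.sum_sub_distrib, Finset.mul_sum]⟩

section PolynomialCount

variable {X : Scheme.{0}} {J : Finset ℕ} {n : ℕ}

theorem IsPolynomialCount.finite_reduction (hX : IsPolynomialCount X J) (p : Nat.Primes) {m : ℕ}
    (hm : 0 < m) : Finite (Spec (CommRingCat.of (GaloisField p m)) ⟶
      pullback (specZIsTerminal.from X)
        (Spec.map (CommRingCat.ofHom (Int.castRingHom (ZMod p))))) := by
  have : NeZero m := ⟨hm.ne'⟩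
  have := hX.finite_hom (GaloisField p m)
  exact Finite.of_equiv _ (reductionPointsEquiv X p (GaloisField p m)).symm

theorem IsPolynomialCount.pointCount_eq (hX : IsPolynomialCount X J) (p : Nat.Primes) {m : ℕ}
    (hm : 0 < m) : pointCount p (reductionMod X p) m = ∑ j ∈ J, ((p : ℕ) ^ m) ^ j := by
  have : NeZero m := ⟨hm.ne'⟩
  rw [pointCount, Nat.card_congr (pointsEquivHom (reductionMod X p) m),
    Nat.card_congr (reductionPointsEquiv X p (GaloisField p m)), hX.natCard_hom,
    GaloisField.card _ _ hm.ne']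

/-- Each monomial `q^j` of the count turns the zeta series into the logarithmic series at
`p^{-(b-j)}`. -/
theorem IsPolynomialCount.hasSum_hasseWeilTerm (hX : IsPolynomialCount X J) (hJ : ∀ j ∈ J, j ≤ n)
    (p : Nat.Primes) {b : ℝ} (hb : (n : ℝ) < b) :
    HasSum (hasseWeilTerm p (reductionMod X p) ((p : ℝ) ^ (-b)))
      (∑ j ∈ J, eulerLog p (b - j)) := by
  have hj : ∀ j ∈ J, HasSum
      (fun m : ℕ => ((p : ℝ) ^ (-(b - j))) ^ (m + 1) / ((m : ℝ) + 1)) (eulerLog p (b - j)) := by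
    intro j hjJ
    have h1 : (j : ℝ) ≤ n := by exact_mod_cast hJ j hjJ
    apply Real.hasSum_pow_div_log_of_abs_lt_one
    rw [abs_of_pos (Real.rpow_pos_of_pos (prime_pos p) _)]
    exact prime_rpow_neg_lt_one p (by linarith)
  refine (hasSum_sum hj).congr_fun fun m => ?_
  rw [hasseWeilTerm, hX.pointCount_eq p m.succ_pos]
  push_cast
  rw [Finset.sum_mul, Finset.sum_div]
  refine Finset.sum_congr rfl fun j _ => ?_
  rw [pow_right_comm, ← mul_pow, ← Real.rpow_natCast (p : ℝ) j, ← Real.rpow_add (prime_pos p)]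
  congr 3
  ring

theorem IsPolynomialCount.localZeta_eq (hX : IsPolynomialCount X J) (hJ : ∀ j ∈ J, j ≤ n)
    (p : Nat.Primes) {b : ℝ} (hb : (n : ℝ) < b) :
    localZeta X b p = Real.exp (∑ j ∈ J, eulerLog p (b - j)) := by
  rw [localZeta, hasseWeilZeta, (hX.hasSum_hasseWeilTerm hJ p hb).tsum_eq]

/-- The energy of a zero-cycle of `X_p`. -/
def zeroCycleEnergy (X : Scheme.{0}) (p : Nat.Primes) (α : EffectiveZeroCycle
    (pullback (specZIsTerminal.from X)
      (Spec.map (CommRingCat.ofHom (Int.castRingHom (ZMod p)))))) : ℝ :=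
  Real.log p * zeroCycleDegree p (reductionMod X p) α

theorem exp_zeroCycleEnergy (p : Nat.Primes) (b : ℝ) (α) :
    Real.exp (-b * zeroCycleEnergy X p α) =
      ((p : ℝ) ^ (-b)) ^ zeroCycleDegree p (reductionMod X p) α := by
  rw [Real.rpow_def_of_pos (prime_pos p), ← Real.exp_nat_mul, zeroCycleEnergy]
  congr 1
  ring

theorem IsPolynomialCount.hasSum_zeroCycle (hX : IsPolynomialCount X J) (hJ : ∀ j ∈ J, j ≤ n)
    (p : Nat.Primes) {b : ℝ} (hb : (n : ℝ) < b) :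
    HasSum (fun α => Real.exp (-b * zeroCycleEnergy X p α)) (localZeta X b p) := by
  have := hX.locallyOfFiniteType
  have := locallyOfFiniteType_reductionMod X p (specZIsTerminal.from X)
  have hb0 : 0 < b := (Nat.cast_nonneg n).trans_lt hb
  simp_rw [exp_zeroCycleEnergy]
  exact hasSum_pow_degree (fun c => residueDegree_pos (reductionMod X p) c.2)
    (N := fun m => (pointCount p (reductionMod X p) m : ℝ))
    (fun m hm => hasSum_residueDegree (reductionMod X p) hm (hX.finite_reduction p hm))
    (Real.rpow_pos_of_pos (prime_pos p) _).le (prime_rpow_neg_lt_one p hb0)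
    (hX.hasSum_hasseWeilTerm hJ p hb).summable

theorem IsPolynomialCount.local_gibbs (hX : IsPolynomialCount X J) (hJ : ∀ j ∈ J, j ≤ n)
    (p : Nat.Primes) {s : ℝ} (hs : (n : ℝ) < s) :
    HasSum (zeroCycleProb p (reductionMod X p) ((p : ℝ) ^ (-s))) 1 ∧
    (Summable fun α => zeroCycleProb p (reductionMod X p) ((p : ℝ) ^ (-s)) α *
      Real.log (zeroCycleProb p (reductionMod X p) ((p : ℝ) ^ (-s)) α)) ∧
    IsOneSubMulDeriv (fun b => Real.log (localZeta X b p)) s (localEntropy X s p) := by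
  have hE : ∀ α, 0 ≤ zeroCycleEnergy X p α := fun α =>
    mul_nonneg (Real.log_nonneg (by exact_mod_cast p.2.one_lt.le)) (Nat.cast_nonneg _)
  have hsum := fun b (hb : (n : ℝ) < b) => hX.hasSum_zeroCycle hJ p hb
  obtain ⟨h1, h2, h3⟩ := gibbs_entropy hE (fun b hb => (hsum b hb).summable) hs
    (hsum s hs).tsum_eq.symm
  have hP : ∀ α, Real.exp (-s * zeroCycleEnergy X p α) / localZeta X s p =
      zeroCycleProb p (reductionMod X p) ((p : ℝ) ^ (-s)) α := fun α => by
    rw [exp_zeroCycleEnergy]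
    rfl
  simp only [hP] at h1 h2 h3
  refine ⟨h1, h2, h3.congr ?_⟩
  filter_upwards [lt_mem_nhds hs] with b hb
  rw [(hsum b hb).tsum_eq]

/-- The Gibbs identity and the explicit zeta function differentiate the same `log Z`; derivatives
are unique. -/
theorem IsPolynomialCount.localEntropy_eq (hX : IsPolynomialCount X J) (hJ : ∀ j ∈ J, j ≤ n)
    (p : Nat.Primes) {s : ℝ} (hs : (n : ℝ) < s) :
    localEntropy X s p = ∑ j ∈ J, (eulerLog p (s - j) - s * eulerLogDeriv p (s - j)) := by
  refine (hX.local_gibbs hJ p hs).2.2.unique ?_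
  refine (isOneSubMulDeriv_sum_shift fun j hj => hasDerivAt_eulerLog p ?_).congr ?_
  · have : (j : ℝ) ≤ n := by exact_mod_cast hJ j hj
    linarith
  · filter_upwards [lt_mem_nhds hs] with b hb
    rw [hX.localZeta_eq hJ p hb, Real.log_exp]

theorem IsPolynomialCount.hasProd_localZeta (hX : IsPolynomialCount X J) (hJ : ∀ j ∈ J, j ≤ n)
    {s : ℝ} (hs : (n : ℝ) + 1 < s) :
    HasProd (localZeta X s) (Real.exp (∑ j ∈ J, logZeta (s - j))) := by
  have h : HasSum (fun p => ∑ j ∈ J, eulerLog p (s - j)) (∑ j ∈ J, logZeta (s - j)) :=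
    hasSum_sum fun j hj => (summable_eulerLog (by
      have : (j : ℝ) ≤ n := by exact_mod_cast hJ j hj
      linarith)).hasSum
  exact h.rexp.congr_fun fun p => hX.localZeta_eq hJ p (by linarith)

theorem IsPolynomialCount.hasSum_localEntropy (hX : IsPolynomialCount X J) (hJ : ∀ j ∈ J, j ≤ n)
    {s : ℝ} (hs : (n : ℝ) + 1 < s) :
    HasSum (localEntropy X s) (∑ j ∈ J, (logZeta (s - j) - s * logZetaDeriv (s - j))) := by
  have hj : ∀ j ∈ J, 1 < s - j := fun j hj => by
    have : (j : ℝ) ≤ n := by exact_mod_cast hJ j hj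
    linarith
  have h : HasSum (fun p => ∑ j ∈ J, (eulerLog p (s - j) - s * eulerLogDeriv p (s - j)))
      (∑ j ∈ J, (logZeta (s - j) - s * logZetaDeriv (s - j))) :=
    hasSum_sum fun j h => (summable_eulerLog (hj j h)).hasSum.sub
      ((summable_eulerLogDeriv (hj j h)).hasSum.mul_left s)
  exact h.congr_fun fun p => hX.localEntropy_eq hJ p (by linarith)

theorem IsPolynomialCount.entropyConverges (hX : IsPolynomialCount X J) (hJ : ∀ j ∈ J, j ≤ n)
    {s : ℝ} (hs : (n : ℝ) + 1 < s) : EntropyConverges X s where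
  finite_points p m hm := by
    have := hX.finite_reduction p hm
    exact Finite.of_equiv _ (pointsEquivHom (reductionMod X p) m).symm
  zeta_series p := (hX.hasSum_hasseWeilTerm hJ p (by linarith)).summable
  probability p := (hX.local_gibbs hJ p (by linarith)).1
  local_entropy p := (hX.local_gibbs hJ p (by linarith)).2.1
  euler_product := (hX.hasProd_localZeta hJ hs).multipliable
  L_pos := by
    rw [LFunctionZ, (hX.hasProd_localZeta hJ hs).tprod_eq]
    exact Real.exp_pos _
  entropy := (hX.hasSum_localEntropy hJ hs).summable

theorem IsPolynomialCount.entropyZ_eq (hX : IsPolynomialCount X J) (hJ : ∀ j ∈ J, j ≤ n)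
    {s : ℝ} (hs : (n : ℝ) + 1 < s) :
    entropyZ X s = ∑ j ∈ J, (logZeta (s - j) - s * logZetaDeriv (s - j)) :=
  (hX.hasSum_localEntropy hJ hs).tsum_eq

theorem IsPolynomialCount.isOneSubMulDeriv_logZeta (hX : IsPolynomialCount X J)
    (hJ : ∀ j ∈ J, j ≤ n) {s : ℝ} (hs : (n : ℝ) + 1 < s) :
    IsOneSubMulDeriv (fun x => ∑ j ∈ J, logZeta (x - j)) s (entropyZ X s) := by
  rw [hX.entropyZ_eq hJ hs]
  refine isOneSubMulDeriv_sum_shift fun j hj => hasDerivAt_logZeta ?_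
  have : (j : ℝ) ≤ n := by exact_mod_cast hJ j hj
  linarith

theorem IsPolynomialCount.isOneSubMulDeriv_LFunctionZ (hX : IsPolynomialCount X J)
    (hJ : ∀ j ∈ J, j ≤ n) {s : ℝ} (hs : (n : ℝ) + 1 < s) :
    IsOneSubMulDeriv (fun x : ℝ => Real.log (LFunctionZ X x)) s (entropyZ X s) := by
  refine (hX.isOneSubMulDeriv_logZeta hJ hs).congr ?_
  filter_upwards [lt_mem_nhds hs] with b hb
  rw [LFunctionZ, (hX.hasProd_localZeta hJ hb).tprod_eq, Real.log_exp]

theorem IsPolynomialCount.isOneSubMulDeriv_riemannZeta (hX : IsPolynomialCount X J)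
    (hJ : ∀ j ∈ J, j ≤ n) {s : ℝ} (hs : (n : ℝ) + 1 < s) :
    IsOneSubMulDeriv (fun z : ℂ => ∑ j ∈ J, Complex.log (riemannZeta (z - j))) (s : ℂ)
      (entropyZ X s : ℂ) := by
  have hj : ∀ j ∈ J, 1 < s - j := fun j hj => by
    have : (j : ℝ) ≤ n := by exact_mod_cast hJ j hj
    linarith
  have h := isOneSubMulDeriv_sum_shift (J := J) (F := fun z : ℂ => Complex.log (riemannZeta z))
    (F' := fun j => (logZetaDeriv (s - j) : ℂ)) (s := (s : ℂ)) fun j h => by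
      have := hasDerivAt_clog_riemannZeta (hj j h)
      push_cast at this
      exact this
  convert! h using 1
  rw [hX.entropyZ_eq hJ hs]
  push_cast
  refine Finset.sum_congr rfl fun j h => ?_
  have := clog_riemannZeta (hj j h)
  push_cast at this
  rw [this]

/-- Near `s` the logarithm of the partition function is `∑_j logZeta (b - j)`; the Dirichlet series
is needed for all such `b` because the entropy involves a derivative. -/
theorem IsPolynomialCount.isThermalEntropy (hX : IsPolynomialCount X J)
    (hJ : ∀ j ∈ J, j ≤ n) {s : ℝ} (hs : (n : ℝ) + 1 < s) {D : ℕ+ → ℕ}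
    (hD : ∀ b : ℝ, (n : ℝ) + 1 < b → HasSum (fun k : ℕ+ => (D k : ℝ) * (k : ℝ) ^ (-b))
      (∏ j ∈ J, Real.exp (logZeta (b - j))))
    (Q : PhysicalSystem) (hQ : Q.HasLogLevels D) : Q.IsThermalEntropy s (entropyZ X s) := by
  refine ⟨(hQ.hasSum_exp (hD s hs)).summable, (hX.isOneSubMulDeriv_logZeta hJ hs).congr ?_⟩
  filter_upwards [lt_mem_nhds hs] with b hb
  rw [PhysicalSystem.partitionFunction, (hQ.hasSum_exp (hD b hb)).tsum_eq, ← Real.exp_sum,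
    Real.log_exp]

end PolynomialCount

theorem hasSum_pow_mul_rpow {n : ℕ} {b : ℝ} (hb : (n : ℝ) + 1 < b) :
    HasSum (fun k : ℕ+ => (((k : ℕ) ^ n : ℕ) : ℝ) * (k : ℝ) ^ (-b))
      (Real.exp (logZeta (b - n))) := by
  refine (hasSum_exp_logZeta (x := b - n) (by linarith)).congr_fun fun k => ?_
  have hk : (0 : ℝ) < (k : ℕ) := by exact_mod_cast k.pos
  rw [Nat.cast_pow, ← Real.rpow_natCast, ← Real.rpow_add hk]
  congr 1
  ring

end

/-! ### The three families of schemes -/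

theorem lemma6p3p1 :
    -- the case of `Spec ℤ`
    ((∀ s : ℝ, 1 < s →
        EntropyConverges (Spec (CommRingCat.of ℤ)) s ∧
        IsOneSubMulDeriv (fun x : ℝ => Real.log (LFunctionZ (Spec (CommRingCat.of ℤ)) x)) s
          (entropyZ (Spec (CommRingCat.of ℤ)) s) ∧
        IsOneSubMulDeriv (fun z : ℂ => Complex.log (riemannZeta z)) (s : ℂ)
          (entropyZ (Spec (CommRingCat.of ℤ)) s : ℂ) ∧
        ∀ Q : PhysicalSystem, Q.HasLogLevels (fun _ => 1) →
          Q.IsThermalEntropy s (entropyZ (Spec (CommRingCat.of ℤ)) s)) ∧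
      PhysicalSystem.julia.HasLogLevels (fun _ => 1) ∧
      PhysicalSystem.bostConnes.HasLogLevels (fun _ => 1)) ∧
    -- the case of affine spaces
    (∀ n : ℕ,
      (∀ s : ℝ, (n : ℝ) + 1 < s →
        EntropyConverges (affineSpaceZ n) s ∧
        IsOneSubMulDeriv (fun x : ℝ => Real.log (LFunctionZ (affineSpaceZ n) x)) s
          (entropyZ (affineSpaceZ n) s) ∧
        IsOneSubMulDeriv (fun z : ℂ => Complex.log (riemannZeta (z - n))) (s : ℂ)
          (entropyZ (affineSpaceZ n) s : ℂ) ∧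
        ∀ Q : PhysicalSystem, Q.HasLogLevels (fun k => (k : ℕ) ^ n) →
          Q.IsThermalEntropy s (entropyZ (affineSpaceZ n) s)) ∧
      ∃ Q : PhysicalSystem, Q.HasLogLevels (fun k => (k : ℕ) ^ n)) ∧
    -- the case of projective spaces
    (∀ n : ℕ,
      (∀ s : ℝ, (n : ℝ) + 1 < s →
        EntropyConverges (projectiveSpaceZ n) s ∧
        IsOneSubMulDeriv (fun x : ℝ => Real.log (LFunctionZ (projectiveSpaceZ n) x)) s
          (entropyZ (projectiveSpaceZ n) s) ∧
        IsOneSubMulDeriv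
          (fun z : ℂ => ∑ m ∈ Finset.range (n + 1), Complex.log (riemannZeta (z - m))) (s : ℂ)
          (entropyZ (projectiveSpaceZ n) s : ℂ) ∧
        ∀ Q : PhysicalSystem, Q.HasLogLevels (fun k => (redSet (n + 1) k).ncard) →
          Q.IsThermalEntropy s (entropyZ (projectiveSpaceZ n) s)) ∧
      (PhysicalSystem.bostConnesGL (n + 1)).HasLogLevels
        (fun k => (redSet (n + 1) k).ncard)) := by
  refine ⟨⟨fun s hs => ?_, PhysicalSystem.julia_hasLogLevels,
    PhysicalSystem.bostConnes_hasLogLevels⟩, fun n => ⟨fun s hs => ?_,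
    PhysicalSystem.exists_hasLogLevels_pow n⟩, fun n => ⟨fun s hs => ?_,
    PhysicalSystem.bostConnesGL_hasLogLevels n⟩⟩
  · have hX := isPolynomialCount_specZ
    have hJ : ∀ j ∈ ({0} : Finset ℕ), j ≤ 0 := by simp
    -- `Spec ℤ` is treated with `n = 0` and `J = {0}`, where `k ^ 0 = 1` is the non-degenerate case.
    have hs' : ((0 : ℕ) : ℝ) + 1 < s := by simpa using hs
    refine ⟨hX.entropyConverges hJ hs', hX.isOneSubMulDeriv_LFunctionZ hJ hs', ?_,
      hX.isThermalEntropy hJ hs' fun b hb => ?_⟩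
    · simpa using hX.isOneSubMulDeriv_riemannZeta hJ hs'
    · simpa using hasSum_pow_mul_rpow hb
  · have hX := isPolynomialCount_affineSpaceZ n
    have hJ : ∀ j ∈ ({n} : Finset ℕ), j ≤ n := by simp
    refine ⟨hX.entropyConverges hJ hs, hX.isOneSubMulDeriv_LFunctionZ hJ hs, ?_,
      hX.isThermalEntropy hJ hs fun b hb => ?_⟩
    · simpa using hX.isOneSubMulDeriv_riemannZeta hJ hs
    · simpa using hasSum_pow_mul_rpow hb
  · have hX := isPolynomialCount_projectiveSpaceZ n
    have hJ : ∀ j ∈ Finset.range (n + 1), j ≤ n := fun j hj =>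
      Nat.lt_succ_iff.1 (Finset.mem_range.1 hj)
    exact ⟨hX.entropyConverges hJ hs, hX.isOneSubMulDeriv_LFunctionZ hJ hs,
      hX.isOneSubMulDeriv_riemannZeta hJ hs, hX.isThermalEntropy hJ hs fun b hb =>
        PosReducedMatrix.hasSum_ncard_redSet (by exact_mod_cast hb)⟩
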